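/- **Conventions.** We work in first-order logic with equality over the language $\{0,S,+,\times\}$. A *theory* is a set $T$ of sentences closed under logical consequence (derivability in classical natural deduction); $T\vdash A$ means $A\in T$; $T$ is an *extension* of $T'$ if $T'\subseteq T$. $\mathsf{PA}$ is the theory axiomatized by Robinson's axioms $\forall x\,\neg Sx=0$; $\forall x,y\,(Sx=Sy\to x=y)$; $\forall x\,(x=0\lor\exists y\,Sy=x)$; $\forall x\; x+0=x$; $\forall x,y\; x+Sy=S(x+y)$; $\forall x\; x\times 0=0$; $\forall x,y\; x\times Sy=x+(x\times y)$, and the (universal closures of all instances of the) induction schema $(P(0)\land\forall x\,(P(x)\to P(Sx)))\to\forall x\,P(x)$. $T$ is *consistent* if there is no sentence $A$ with $T\vdash A$ and $T\vdash\neg A$. "True" means true in the standard model $\mathbb N$. Formulas are strings over an alphabet with $k=10$ letters, in which $\neg A$ is the letter $\neg$ followed by the string $A$; a string is regarded as the natural number it denotes in base $k$. For $n\in\mathbb N$, $\ulcorner n\urcorner$ is the numeral $S\cdots S0$ with $n$ occurrences of $S$; in particular $\ulcorner A\urcorner$ and $\ulcorner\neg\urcorner$ are the numerals of the formula $A$ and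 of the one-letter string $\neg$. For $a,b\in\mathbb N$, $a\frown b$ is the number written with the base-$k$ digits of $a$ followed by those of $b$. $T$ is *computably enumerable* if there is a computable $\mathrm{pc}\colon\mathbb N^2\to\{\text{reject},\text{accept}\}$ such that for every $a\in\mathbb N$: $\mathrm{pc}(p,a)$ accepts for some $p$ if $a$ is (the number of) a sentence $A$ with $T\vdash A$, and for no $p$ otherwise. A formula $r(x,y,z)$ *correctly represents* $\frown$ in $T$ if for all $a,b\in\mathbb N$, $T\vdash(\exists!z\;r(\ulcorner a\urcorner,\ulcorner b\urcorner,z))\land r(\ulcorner a\urcorner,\ulcorner b\urcorner,\ulcorner a\frown b\urcorner)$, and for all $a,b,c\in\mathbb N$ the sentence $r(\ulcorner a\urcorner,\ulcorner b\urcorner,\ulcorner c\urcorner)$ is true if and only if $a\frown b=c$. Given such an $r$ and a formula $P(x)$, $P(\ulcorner\neg\urcorner\frown x)$ abbreviates $(\exists!y\;r(\ulcorner\neg\urcorner,x,y))\land\exists y\,(r(\ulcorner\neg\urcorner,x,y)\land P(y))$. A formula $\mathrm{Pvb}(x)$ is a *weak provability predicate* for $T$ if for every sentence $A$: (correctness)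 $\mathrm{Pvb}(\ulcorner A\urcorner)$ is true if and only if $T\vdash A$; (representability) if $T\vdash A$, then $T\vdash\mathrm{Pvb}(\ulcorner A\urcorner)$. **Theorem (Little Second Incompleteness Theorem, Rosser's version).** Let $T$ be a consistent and computably enumerable extension of $\mathsf{PA}$. Then there is a formula which correctly represents $\frown$ in $T$, and for every such formula $r$ there is a weak provability predicate $\mathrm{Pvb}$ for $T$ such that the consistency statement $$\mathrm{Con}\;:=\;\neg\exists x\,\bigl(\mathrm{Pvb}(x)\land\mathrm{Pvb}(\ulcorner\neg\urcorner\frown x)\bigr)$$ is undecidable in $T$: neither $T\vdash\mathrm{Con}$ nor $T\vdash\neg\mathrm{Con}$. -/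

import Mathlib

/-! First-order arithmetic: formal strings, natural deduction, truth, theories, Peano arithmetic,
representation of functions, provability predicates and consistency statements. -/

namespace PeanoArith

/-! ### Terms and formulas of the language of arithmetic

Variables are de Bruijn indices: `var i` refers to the `i`-th enclosing quantifier, counted from the
innermost one; indices that exceed the number of enclosing quantifiers are free variables. -/

/-- Terms of the language `0, S, +, ×`. -/
inductive Term : Type
  | var : ℕ → Term
  | zero : Term
  | succ : Term → Term
  | add : Term → Term → Term
  | mul : Term → Term → Term

/-- First-order formulas with equality. -/
inductive Formula : Type
  | eq : Term → Term → Formula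
  | neg : Formula → Formula
  | imp : Formula → Formula → Formula
  | all : Formula → Formula

namespace Formula

/-- Conjunction. -/
def and (φ ψ : Formula) : Formula := neg (imp φ (neg ψ))

/-- Existential quantification. -/
def ex (φ : Formula) : Formula := neg (all (neg φ))

/-- Disjunction. -/
def or (φ ψ : Formula) : Formula := imp (neg φ) ψ

end Formula

/-! ### Substitution -/

/-- Simultaneous substitution in a term. -/
def Term.subst (σ : ℕ → Term) : Term → Term
  | .var i => σ i
  | .zero => .zero
  | .succ t => .succ (t.subst σ)
  | .add s t => .add (s.subst σ) (t.subst σ)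
  | .mul s t => .mul (s.subst σ) (t.subst σ)

/-- Rename every variable `i` to `i + 1`. -/
def Term.shift (t : Term) : Term := t.subst fun i => .var (i + 1)

/-- The substitution to be used below one more quantifier. -/
def up (σ : ℕ → Term) : ℕ → Term
  | 0 => .var 0
  | i + 1 => (σ i).shift

/-- Simultaneous capture-avoiding substitution in a formula. -/
def Formula.subst (σ : ℕ → Term) : Formula → Formula
  | .eq s t => .eq (s.subst σ) (t.subst σ)
  | .neg φ => .neg (φ.subst σ)
  | .imp φ ψ => .imp (φ.subst σ) (ψ.subst σ)
  | .all φ => .all (φ.subst (up σ))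

/-- Rename every free variable `i` to `i + 1`. -/
def Formula.shift (φ : Formula) : Formula := φ.subst fun i => .var (i + 1)

/-- `φ.app [t₀, …, tₖ₋₁]` is `φ(t₀, …, tₖ₋₁)`: the first `k` free variables are replaced by the
given terms, and the further ones are renumbered from `0`. -/
def Formula.app (φ : Formula) (ts : List Term) : Formula :=
  φ.subst fun i => ts.getD i (.var (i - ts.length))

/-! ### Sentences -/

/-- All variables of the term are `< n`. -/
def Term.ClosedAt (n : ℕ) : Term → Prop
  | .var i => i < n
  | .zero => True
  | .succ t => t.ClosedAt n
  | .add s t => s.ClosedAt n ∧ t.ClosedAt n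
  | .mul s t => s.ClosedAt n ∧ t.ClosedAt n

/-- All free variables of the formula are `< n`. -/
def Formula.ClosedAt : ℕ → Formula → Prop
  | n, .eq s t => s.ClosedAt n ∧ t.ClosedAt n
  | n, .neg φ => φ.ClosedAt n
  | n, .imp φ ψ => φ.ClosedAt n ∧ ψ.ClosedAt n
  | n, .all φ => φ.ClosedAt (n + 1)

/-- A sentence is a formula without free variables. -/
def Formula.IsSentence (φ : Formula) : Prop := φ.ClosedAt 0

/-! ### Truth in the intended interpretation -/

/-- The value of a term in `ℕ`. -/
def Term.eval (v : ℕ → ℕ) : Term → ℕ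
  | .var i => v i
  | .zero => 0
  | .succ t => t.eval v + 1
  | .add s t => s.eval v + t.eval v
  | .mul s t => s.eval v * t.eval v

/-- Satisfaction in `ℕ` under an assignment of the free variables. -/
def Formula.Holds : (ℕ → ℕ) → Formula → Prop
  | v, .eq s t => s.eval v = t.eval v
  | v, .neg φ => ¬ φ.Holds v
  | v, .imp φ ψ => φ.Holds v → ψ.Holds v
  | v, .all φ => ∀ a : ℕ, φ.Holds fun i => Nat.casesOn i a v

/-- Truth in `ℕ`, used for sentences only (the assignment is then irrelevant). -/
def Formula.IsTrue (φ : Formula) : Prop := φ.Holds fun _ => 0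

/-! ### Formal strings as natural numbers

Formulas are strings over a ten letter alphabet, in prefix notation; the variable with index `i` is
the string of `i` strokes followed by `x`. Such a string is read as a number written in base ten.
The stroke is the digit `0`; it is never the first letter of a formula. -/

/-- The alphabet. -/
inductive Letter : Type
  | stroke | x | zero | succ | add | mul | eq | neg | imp | all

/-- The digit that a letter stands for. -/
def Letter.digit : Letter → ℕ
  | .stroke => 0
  | .x => 1
  | .zero => 2
  | .succ => 3
  | .add => 4
  | .mul => 5
  | .eq => 6
  | .neg => 7
  | .imp => 8
  | .all => 9

/-- The string of a term. -/
def Term.string : Term → List Letter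
  | .var i => List.replicate i .stroke ++ [.x]
  | .zero => [.zero]
  | .succ t => .succ :: t.string
  | .add s t => .add :: (s.string ++ t.string)
  | .mul s t => .mul :: (s.string ++ t.string)

/-- The string of a formula. -/
def Formula.string : Formula → List Letter
  | .eq s t => .eq :: (s.string ++ t.string)
  | .neg φ => .neg :: φ.string
  | .imp φ ψ => .imp :: (φ.string ++ ψ.string)
  | .all φ => .all :: φ.string

/-- The number that a string denotes in base ten, first letter most significant. -/
def stringNumber (l : List Letter) : ℕ := l.foldl (fun n a => 10 * n + a.digit) 0

/-- The formula as a number. -/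
def Formula.code (φ : Formula) : ℕ := stringNumber φ.string

/-- The one letter string `¬` as a number. -/
def negCode : ℕ := stringNumber [.neg]

/-- Concatenation of numbers: the number written with the digits of `a` followed by the digits of
`b`. A number `b` has `Nat.log 10 b + 1` decimal digits. -/
def cat (a b : ℕ) : ℕ := a * 10 ^ (Nat.log 10 b + 1) + b

/-- The numeral `S…S0` of a natural number. -/
def num : ℕ → Term
  | 0 => .zero
  | n + 1 => .succ (num n)

/-! ### Natural deduction -/

/-- `Derives Γ φ`: the formula `φ` is derivable from the assumptions `Γ` in classical natural
deduction for first-order logic with equality. -/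
inductive Derives : Set Formula → Formula → Prop
  | assumption {Γ : Set Formula} {φ : Formula} : φ ∈ Γ → Derives Γ φ
  | impIntro {Γ : Set Formula} {φ ψ : Formula} :
      Derives (insert φ Γ) ψ → Derives Γ (.imp φ ψ)
  | impElim {Γ : Set Formula} {φ ψ : Formula} :
      Derives Γ (.imp φ ψ) → Derives Γ φ → Derives Γ ψ
  | negIntro {Γ : Set Formula} {φ ψ : Formula} :
      Derives (insert φ Γ) ψ → Derives (insert φ Γ) (.neg ψ) → Derives Γ (.neg φ)
  | byContradiction {Γ : Set Formula} {φ ψ : Formula} :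
      Derives (insert (.neg φ) Γ) ψ → Derives (insert (.neg φ) Γ) (.neg ψ) → Derives Γ φ
  | allIntro {Γ : Set Formula} {φ : Formula} :
      Derives (Formula.shift '' Γ) φ → Derives Γ (.all φ)
  | allElim {Γ : Set Formula} {φ : Formula} (t : Term) :
      Derives Γ (.all φ) → Derives Γ (φ.app [t])
  | eqRefl {Γ : Set Formula} (t : Term) : Derives Γ (.eq t t)
  | eqSubst {Γ : Set Formula} (φ : Formula) {s t : Term} :
      Derives Γ (.eq s t) → Derives Γ (φ.app [s]) → Derives Γ (φ.app [t])

/-! ### Theories -/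

/-- A theory is a set of sentences that is closed under logical consequence. -/
def IsTheory (T : Set Formula) : Prop :=
  (∀ A ∈ T, A.IsSentence) ∧ ∀ A : Formula, A.IsSentence → Derives T A → A ∈ T

/-- `T ⊢ A`. -/
def Proves (T : Set Formula) (A : Formula) : Prop := A ∈ T

/-- No sentence is provable together with its negation. -/
def Consistent (T : Set Formula) : Prop :=
  ¬ ∃ A : Formula, A.IsSentence ∧ Proves T A ∧ Proves T (.neg A)

/-- The theory with the given axioms. -/
def theoryOf (Ax : Set Formula) : Set Formula := {A | A.IsSentence ∧ Derives Ax A}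

/-- The axioms of Robinson arithmetic. -/
inductive RobinsonAxiom : Formula → Prop
  /-- `∀ x, ¬ S x = 0` -/
  | s0 : RobinsonAxiom (.all (.neg (.eq (.succ (.var 0)) .zero)))
  /-- `∀ x y, S x = S y → x = y` -/
  | s1 : RobinsonAxiom (.all (.all (.imp (.eq (.succ (.var 1)) (.succ (.var 0)))
      (.eq (.var 1) (.var 0)))))
  /-- `∀ x, x = 0 ∨ ∃ y, S y = x` -/
  | s2 : RobinsonAxiom (.all (.or (.eq (.var 0) .zero) (.ex (.eq (.succ (.var 0)) (.var 1)))))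
  /-- `∀ x, x + 0 = x` -/
  | a0 : RobinsonAxiom (.all (.eq (.add (.var 0) .zero) (.var 0)))
  /-- `∀ x y, x + S y = S (x + y)` -/
  | a1 : RobinsonAxiom (.all (.all (.eq (.add (.var 1) (.succ (.var 0)))
      (.succ (.add (.var 1) (.var 0))))))
  /-- `∀ x, x × 0 = 0` -/
  | m0 : RobinsonAxiom (.all (.eq (.mul (.var 0) .zero) .zero))
  /-- `∀ x y, x × S y = x + (x × y)` -/
  | m1 : RobinsonAxiom (.all (.all (.eq (.mul (.var 1) (.succ (.var 0)))
      (.add (.var 1) (.mul (.var 1) (.var 0))))))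

/-- Prefix `n` universal quantifiers. -/
def Formula.allN : ℕ → Formula → Formula
  | 0, φ => φ
  | n + 1, φ => .all (allN n φ)

/-- `(P(0) ∧ ∀ x, P(x) → P(S x)) → ∀ x, P(x)`, where `x` is the free variable `0` of `P`, and the
other free variables of `P` are parameters. -/
def Formula.induction (P : Formula) : Formula :=
  .imp
    (.and (P.app [.zero])
      (.all (.imp P (P.subst fun i => if i = 0 then .succ (.var 0) else .var i))))
    (.all P)

/-- The axioms of Peano arithmetic: those of Robinson arithmetic, and the universal closures of all
instances of the induction schema. -/
def PAAxioms : Set Formula :=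
  {A | RobinsonAxiom A} ∪ {A | A.IsSentence ∧ ∃ (n : ℕ) (P : Formula), A = P.induction.allN n}

/-- Peano arithmetic. -/
def PA : Set Formula := theoryOf PAAxioms

/-- `T` is an extension of `T'`. -/
def IsExtension (T T' : Set Formula) : Prop := T' ⊆ T

/-- A proof verifier for `T`; `true` stands for acceptance. A number is accepted with some proof
if it is a theorem of `T`, and with no proof otherwise. -/
def IsProofVerifier (T : Set Formula) (pc : ℕ → ℕ → Bool) : Prop :=
  ∀ a : ℕ, (∃ p, pc p a = true) ↔ ∃ A : Formula, A.IsSentence ∧ A.code = a ∧ Proves T A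

/-- `T` is computably enumerable if it has a computable proof verifier. -/
def IsComputablyEnumerable (T : Set Formula) : Prop :=
  ∃ pc : ℕ → ℕ → Bool, Computable₂ pc ∧ IsProofVerifier T pc

/-! ### Representation -/

/-- `∃! y, φ(y)`, that is `∃ y, φ(y) ∧ ∀ z, φ(z) → z = y`, where `y` is the free variable `0`. -/
def Formula.exUnique (φ : Formula) : Formula :=
  .ex (.and φ (.all (.imp (φ.subst fun i => if i = 0 then .var 0 else .var (i + 1))
    (.eq (.var 0) (.var 1)))))

/-- The formula `r(x, y, z)` represents the function `f` of two variables in `T`: if `f(a, b) = c`,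
then `T` proves `(∃! z, r(a, b, z)) ∧ r(a, b, c)`. -/
def Represents₂ (T : Set Formula) (r : Formula) (f : ℕ → ℕ → ℕ) : Prop :=
  r.ClosedAt 3 ∧ ∀ a b : ℕ,
    Proves T (.and (.exUnique (r.app [num a, num b, .var 0])) (r.app [num a, num b, num (f a b)]))

/-- The formula `r` correctly represents `f` in `T`: it represents `f`, and moreover `r(a, b, c)` is
true if and only if `f(a, b) = c`. -/
def CorrectlyRepresents₂ (T : Set Formula) (r : Formula) (f : ℕ → ℕ → ℕ) : Prop :=
  Represents₂ T r f ∧ ∀ a b c : ℕ, (r.app [num a, num b, num c]).IsTrue ↔ f a b = c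

/-- `P(f(s, t))` where `r` represents `f`, that is
`(∃! y, r(s, t, y)) ∧ (∃ y, r(s, t, y) ∧ P(y))`. -/
def appFun₂ (P r : Formula) (s t : Term) : Formula :=
  .and (.exUnique (r.app [s.shift, t.shift, .var 0]))
    (.ex (.and (r.app [s.shift, t.shift, .var 0]) (P.app [.var 0])))

/-! ### Provability predicates and consistency statements -/

/-- `P` is a weak provability predicate for `T`: a formula in one free variable such that, for every
sentence `A`, `P(⌜A⌝)` is true if and only if `T ⊢ A` (correctness), and `T ⊢ A` implies
`T ⊢ P(⌜A⌝)` (representability). -/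
def IsWeakProvabilityPredicate (T : Set Formula) (P : Formula) : Prop :=
  P.ClosedAt 1 ∧ ∀ A : Formula, A.IsSentence →
    ((P.app [num A.code]).IsTrue ↔ Proves T A) ∧
    (Proves T A → Proves T (P.app [num A.code]))

/-- The consistency statement `¬ ∃ x, P(x) ∧ P(⌜¬⌝ ⌢ x)`, where the concatenation `⌢` is expressed
by the formula `r`. -/
def consistencyStatement (r P : Formula) : Formula :=
  .neg (.ex (.and (P.app [.var 0]) (appFun₂ P r (num negCode) (.var 0))))

/-- The sentence `A` is undecidable in `T`: neither provable nor refutable. -/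
def Undecidable (T : Set Formula) (A : Formula) : Prop :=
  ¬ Proves T A ∧ ¬ Proves T (.neg A)

end PeanoArith

namespace PeanoArith

/-! ### Substitution -/

/-! The provability predicate is built so that its consistency statement is equivalent in `T` to the
negation of a sentence `ρ` already known to be false and undecidable. Let `f` be a total computable
enumeration of the codes of the theorems, and let `E` represent its graph. Put `Pvb(x) := ρ ∨ ∃ p,
(E(x, p) ∧ no two theorems with index at most p are a formula and its negation)`.

If `ρ` holds, `Pvb` holds of everything and `Con` fails. If `ρ` fails, suppose `x` and `¬x` both
satisfy `Pvb`, with indices `p` and `q`. Then the clause belonging to the larger index is violated,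
so `Con` holds. This argument works in every model of `T`, hence `Con` is as undecidable as `ρ`
(`exists_weakProvabilityPredicate_undecidable`). Correctness holds because `ρ` is false and `T`
really is consistent. Representability holds because, in any model, only standard indices lie below
a standard index, and there `E` and `r` have their intended meaning.

The sentence `ρ` comes from the first incompleteness theorem (`exists_undecidable`): one of an
undecidable sentence and its negation is false. If `T` decided every sentence, it would be
computable whether `T` proves that program `e` outputs `0` on input `e`. A program that outputs the
opposite of this verdict then refutes it at its own index. Only consistency of `T` is needed, since
the diagonal program is total and its output is decided by `T`.

Membership in `T` is always shown semantically, by completeness (`IsTheory.mem_of_forall_sat`), so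
no formal derivations in `PA` are constructed. The arithmetical input is that standard numbers form
an initial segment of every model (`PAModel.lt_emb_iff`), so that formulas with bounded quantifiers
are absolute. Graphs of partial recursive functions are projections of absolute relations
(`sig_of_partrec`), and bounding the witness minimally turns them into formulas that pin down the
value in every model (`Sig.exists_representation`). -/

theorem Term.subst_subst (σ τ : ℕ → Term) (t : Term) :
    (t.subst σ).subst τ = t.subst fun i => (σ i).subst τ := by
  induction t <;> simp_all [Term.subst]

theorem Term.subst_var (t : Term) : t.subst .var = t := by
  induction t <;> simp_all [Term.subst]

theorem up_subst (σ τ : ℕ → Term) :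
    (fun i => (up σ i).subst (up τ)) = up fun i => (σ i).subst τ := by
  funext i
  cases i <;> simp [up, Term.subst, Term.shift, Term.subst_subst]

theorem up_var : up .var = .var := by
  funext i
  cases i <;> simp [up, Term.subst, Term.shift]

theorem Formula.subst_subst (σ τ : ℕ → Term) (φ : Formula) :
    (φ.subst σ).subst τ = φ.subst fun i => (σ i).subst τ := by
  induction φ generalizing σ τ <;> simp_all [Formula.subst, Term.subst_subst, up_subst]

theorem Formula.subst_var (φ : Formula) : φ.subst .var = φ := by
  induction φ <;> simp_all [Formula.subst, Term.subst_var, up_var]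

/-- The sequence with first entry `a` and the entries of `v` thereafter. -/
def cons {M : Type*} (a : M) (v : ℕ → M) : ℕ → M := fun i => Nat.casesOn i a v

@[simp] theorem cons_zero {M : Type*} (a : M) (v : ℕ → M) : cons a v 0 = a := rfl

@[simp] theorem cons_succ {M : Type*} (a : M) (v : ℕ → M) (i : ℕ) : cons a v (i + 1) = v i := rfl

@[simp] theorem cons_one {M : Type*} (a : M) (v : ℕ → M) : cons a v 1 = v 0 := rfl

theorem comp_cons {M N : Type*} (f : M → N) (a : M) (v : ℕ → M) :
    (fun i => f (cons a v i)) = cons (f a) fun i => f (v i) := by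
  funext i
  cases i <;> rfl

theorem cons_ext {M : Type*} {v : ℕ → M} {a : M} {w : ℕ → M} (h₀ : v 0 = a)
    (h : ∀ i, v (i + 1) = w i) : v = cons a w := by
  funext i
  cases i
  exacts [h₀, h _]

theorem Formula.app_singleton (φ : Formula) (t : Term) : φ.app [t] = φ.subst (cons t .var) := by
  unfold Formula.app
  congr 1
  exact cons_ext (by simp) (by simp)

theorem Term.shift_subst_cons (s t : Term) (σ : ℕ → Term) :
    t.shift.subst (cons s σ) = t.subst σ := by
  simp [Term.shift, Term.subst_subst, Term.subst]

theorem Formula.subst_up_app (φ : Formula) (t : Term) (σ : ℕ → Term) :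
    (φ.subst (up σ)).app [t] = φ.subst (cons t σ) := by
  rw [app_singleton, subst_subst]
  congr 1
  exact cons_ext (by simp [up, Term.subst])
    (by simp [up, Term.shift_subst_cons, Term.subst_var])

theorem Formula.app_subst (φ : Formula) (t : Term) (σ : ℕ → Term) :
    (φ.app [t]).subst σ = (φ.subst (up σ)).app [t.subst σ] := by
  rw [subst_up_app, app_singleton, subst_subst]
  congr 1
  exact cons_ext (by simp) (by simp [Term.subst])

theorem Formula.shift_subst_up (φ : Formula) (σ : ℕ → Term) :
    φ.shift.subst (up σ) = (φ.subst σ).shift := by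
  simp [Formula.shift, subst_subst, Term.subst, up, Term.shift]

/-! ### Free variables -/

theorem Term.ClosedAt.mono {n m : ℕ} (h : n ≤ m) {t : Term} (ht : t.ClosedAt n) :
    t.ClosedAt m := by
  induction t <;> simp_all [Term.ClosedAt]; omega

theorem Formula.ClosedAt.mono {n m : ℕ} (h : n ≤ m) {φ : Formula} (hφ : φ.ClosedAt n) :
    φ.ClosedAt m := by
  induction φ generalizing n m with
  | eq s t => exact ⟨hφ.1.mono h, hφ.2.mono h⟩
  | neg φ ih => exact ih h hφ
  | imp φ ψ ih₁ ih₂ => exact ⟨ih₁ h hφ.1, ih₂ h hφ.2⟩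
  | all φ ih => exact ih (n := n + 1) (by omega) hφ

theorem Term.exists_closedAt (t : Term) : ∃ n, t.ClosedAt n := by
  induction t with
  | var i => exact ⟨i + 1, Nat.lt_succ_self i⟩
  | zero => exact ⟨0, trivial⟩
  | succ t ih => exact ih
  | add s t ih₁ ih₂ | mul s t ih₁ ih₂ =>
    obtain ⟨n, hn⟩ := ih₁
    obtain ⟨m, hm⟩ := ih₂
    exact ⟨max n m, hn.mono (le_max_left ..), hm.mono (le_max_right ..)⟩

theorem Formula.exists_closedAt (φ : Formula) : ∃ n, φ.ClosedAt n := by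
  induction φ with
  | eq s t =>
    obtain ⟨n, hn⟩ := s.exists_closedAt
    obtain ⟨m, hm⟩ := t.exists_closedAt
    exact ⟨max n m, hn.mono (le_max_left ..), hm.mono (le_max_right ..)⟩
  | neg φ ih => exact ih
  | imp φ ψ ih₁ ih₂ =>
    obtain ⟨n, hn⟩ := ih₁
    obtain ⟨m, hm⟩ := ih₂
    exact ⟨max n m, hn.mono (le_max_left ..), hm.mono (le_max_right ..)⟩
  | all φ ih =>
    obtain ⟨n, hn⟩ := ih
    exact ⟨n, Formula.ClosedAt.mono (n := n) (m := n + 1) (by omega) hn⟩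

theorem Term.subst_congr {n : ℕ} {σ τ : ℕ → Term} (h : ∀ i < n, σ i = τ i) {t : Term}
    (ht : t.ClosedAt n) : t.subst σ = t.subst τ := by
  induction t <;> simp_all [Term.ClosedAt, Term.subst]

theorem Formula.subst_congr {n : ℕ} {σ τ : ℕ → Term} (h : ∀ i < n, σ i = τ i) {φ : Formula}
    (hφ : φ.ClosedAt n) : φ.subst σ = φ.subst τ := by
  induction φ generalizing n σ τ with
  | eq s t => simp [Formula.subst, Term.subst_congr h hφ.1, Term.subst_congr h hφ.2]
  | neg φ ih => simp [Formula.subst, ih h hφ]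
  | imp φ ψ ih₁ ih₂ => simp [Formula.subst, ih₁ h hφ.1, ih₂ h hφ.2]
  | all φ ih =>
    have := ih (n := n + 1) (σ := up σ) (τ := up τ) (fun i hi => by
      cases i with
      | zero => rfl
      | succ i => simp [up, h i (by omega)]) hφ
    simp [Formula.subst, this]

theorem Formula.IsSentence.subst {φ : Formula} (hφ : φ.IsSentence) (σ : ℕ → Term) :
    φ.subst σ = φ := by
  conv_rhs => rw [← φ.subst_var]
  exact subst_congr (n := 0) (by simp) hφ

theorem Term.ClosedAt.subst {n m : ℕ} {σ : ℕ → Term} {t : Term} (ht : t.ClosedAt n)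
    (h : ∀ i < n, (σ i).ClosedAt m) : (t.subst σ).ClosedAt m := by
  induction t <;> simp_all [Term.ClosedAt, Term.subst]

theorem Term.ClosedAt.shift {n : ℕ} {t : Term} (ht : t.ClosedAt n) : t.shift.ClosedAt (n + 1) :=
  ht.subst fun i hi => by simpa [Term.ClosedAt] using hi

theorem up_closedAt {n m : ℕ} {σ : ℕ → Term} (h : ∀ i < n, (σ i).ClosedAt m) :
    ∀ i < n + 1, (up σ i).ClosedAt (m + 1) := by
  intro i hi
  cases i with
  | zero => simp [up, Term.ClosedAt]
  | succ i => exact (h i (by omega)).shift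

theorem Formula.ClosedAt.subst {n m : ℕ} {σ : ℕ → Term} {φ : Formula} (hφ : φ.ClosedAt n)
    (h : ∀ i < n, (σ i).ClosedAt m) : (φ.subst σ).ClosedAt m := by
  induction φ generalizing n m σ with
  | eq s t => exact ⟨hφ.1.subst h, hφ.2.subst h⟩
  | neg φ ih => exact ih hφ h
  | imp φ ψ ih₁ ih₂ => exact ⟨ih₁ hφ.1 h, ih₂ hφ.2 h⟩
  | all φ ih => exact ih (n := n + 1) (m := m + 1) hφ (up_closedAt h)

theorem Formula.ClosedAt.app {n m : ℕ} {φ : Formula} {ts : List Term} (hφ : φ.ClosedAt n)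
    (hn : n ≤ ts.length) (h : ∀ t ∈ ts, t.ClosedAt m) : (φ.app ts).ClosedAt m :=
  hφ.subst fun i hi => by
    rw [List.getD_eq_getElem _ _ (by omega)]
    exact h _ (List.getElem_mem _)

theorem num_closedAt (n m : ℕ) : (num n).ClosedAt m := by
  induction n with
  | zero => trivial
  | succ n ih => exact ih

/-! ### Structures for the language of arithmetic -/

/-- A structure for the language `0, S, +, ×`. -/
class ArithStructure (M : Type) where
  /-- The interpretation of `0`. -/
  zero : M
  /-- The interpretation of `S`. -/
  succ : M → M
  /-- The interpretation of `+`. -/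
  add : M → M → M
  /-- The interpretation of `×`. -/
  mul : M → M → M

instance : ArithStructure ℕ := ⟨0, (· + 1), (· + ·), (· * ·)⟩

section

variable {M : Type} [ArithStructure M]

/-- The value of a term. -/
def Term.val (v : ℕ → M) : Term → M
  | .var i => v i
  | .zero => ArithStructure.zero
  | .succ t => ArithStructure.succ (t.val v)
  | .add s t => ArithStructure.add (s.val v) (t.val v)
  | .mul s t => ArithStructure.mul (s.val v) (t.val v)

/-- Satisfaction in a structure. -/
def Formula.Sat : (ℕ → M) → Formula → Prop
  | v, .eq s t => s.val v = t.val v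
  | v, .neg φ => ¬ φ.Sat v
  | v, .imp φ ψ => φ.Sat v → ψ.Sat v
  | v, .all φ => ∀ a : M, φ.Sat (cons a v)

variable (v : ℕ → M) (φ ψ : Formula)

@[simp] theorem sat_eq (s t : Term) : (Formula.eq s t).Sat v ↔ s.val v = t.val v := Iff.rfl

@[simp] theorem sat_neg : φ.neg.Sat v ↔ ¬ φ.Sat v := Iff.rfl

@[simp] theorem sat_imp : (φ.imp ψ).Sat v ↔ (φ.Sat v → ψ.Sat v) := Iff.rfl

@[simp] theorem sat_all : φ.all.Sat v ↔ ∀ a : M, φ.Sat (cons a v) := Iff.rfl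

@[simp] theorem sat_and : (φ.and ψ).Sat v ↔ φ.Sat v ∧ ψ.Sat v := by simp [Formula.and]

@[simp] theorem sat_or : (φ.or ψ).Sat v ↔ φ.Sat v ∨ ψ.Sat v := by
  simp [Formula.or, or_iff_not_imp_left]

@[simp] theorem sat_ex : φ.ex.Sat v ↔ ∃ a : M, φ.Sat (cons a v) := by simp [Formula.ex]

@[simp] theorem val_subst (σ : ℕ → Term) (t : Term) :
    (t.subst σ).val v = t.val fun i => (σ i).val v := by
  induction t <;> simp_all [Term.val, Term.subst]

@[simp] theorem val_shift (a : M) (t : Term) : t.shift.val (cons a v) = t.val v := by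
  simp [Term.shift, Term.val]

@[simp] theorem sat_subst (σ : ℕ → Term) :
    (φ.subst σ).Sat v ↔ φ.Sat fun i => (σ i).val v := by
  induction φ generalizing v σ with
  | eq s t => simp [Formula.subst]
  | neg φ ih => simp [Formula.subst, ih]
  | imp φ ψ ih₁ ih₂ => simp [Formula.subst, ih₁, ih₂]
  | all φ ih =>
    simp only [Formula.subst, sat_all, ih]
    refine forall_congr' fun a => ?_
    rw [cons_ext (v := fun i => (up σ i).val (cons a v)) (a := a) (w := fun i => (σ i).val v)
      rfl (by simp [up])]

@[simp] theorem sat_app (ts : List Term) :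
    (φ.app ts).Sat v ↔ φ.Sat (ts.foldr (fun t w => cons (t.val v) w) v) := by
  rw [Formula.app, sat_subst]
  congr! 1
  funext i
  induction ts generalizing i with
  | nil => simp [Term.val]
  | cons t ts ih => cases i <;> simp_all

theorem sat_exUnique : φ.exUnique.Sat v ↔ ∃! a : M, φ.Sat (cons a v) := by
  simp only [Formula.exUnique, sat_ex, sat_and, sat_all, sat_imp, sat_eq, sat_subst, Term.val,
    cons_zero, cons_one, ExistsUnique]
  refine exists_congr fun a => and_congr_right fun _ => forall_congr' fun b => ?_
  rw [cons_ext (v := fun i => Term.val (cons b (cons a v))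
    (if i = 0 then Term.var 0 else Term.var (i + 1))) (a := b) (w := v) rfl (by simp [Term.val])]

end

section

variable {M : Type} [ArithStructure M] {v w : ℕ → M} {n : ℕ}

theorem Term.ClosedAt.val_congr {t : Term} (ht : t.ClosedAt n) (h : ∀ i < n, v i = w i) :
    t.val v = t.val w := by
  induction t <;> simp_all [Term.ClosedAt, Term.val]

theorem Formula.ClosedAt.sat_congr {φ : Formula} (hφ : φ.ClosedAt n) (h : ∀ i < n, v i = w i) :
    φ.Sat v ↔ φ.Sat w := by
  induction φ generalizing n v w with
  | eq s t => simp [hφ.1.val_congr h, hφ.2.val_congr h]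
  | neg φ ih => simp [ih hφ h]
  | imp φ ψ ih₁ ih₂ => simp [ih₁ hφ.1 h, ih₂ hφ.2 h]
  | all φ ih =>
    refine forall_congr' fun a => ih (n := n + 1) hφ fun i hi => ?_
    cases i with
    | zero => rfl
    | succ i => exact h i (by omega)

theorem Formula.IsSentence.sat_congr {φ : Formula} (hφ : φ.IsSentence) : φ.Sat v ↔ φ.Sat w :=
  ClosedAt.sat_congr hφ (by simp)

end

theorem eval_eq_val (v : ℕ → ℕ) (t : Term) : t.eval v = t.val v := by
  induction t with
  | var i => rfl
  | zero => rfl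
  | succ t ih => exact congrArg (· + 1) ih
  | add s t ih₁ ih₂ => exact congrArg₂ (· + ·) ih₁ ih₂
  | mul s t ih₁ ih₂ => exact congrArg₂ (· * ·) ih₁ ih₂

theorem holds_iff_sat (v : ℕ → ℕ) (φ : Formula) : φ.Holds v ↔ φ.Sat v := by
  induction φ generalizing v with
  | eq s t => simp [Formula.Holds, eval_eq_val]
  | neg φ ih => simp [Formula.Holds, ih]
  | imp φ ψ ih₁ ih₂ => simp [Formula.Holds, ih₁, ih₂]
  | all φ ih => exact forall_congr' fun a => ih _

/-! ### Derivations -/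

theorem Derives.mono {Γ Δ : Set Formula} {φ : Formula} (h : Derives Γ φ) (hΓ : Γ ⊆ Δ) :
    Derives Δ φ := by
  induction h generalizing Δ with
  | assumption h => exact .assumption (hΓ h)
  | impIntro _ ih => exact .impIntro (ih (Set.insert_subset_insert hΓ))
  | impElim _ _ ih₁ ih₂ => exact .impElim (ih₁ hΓ) (ih₂ hΓ)
  | negIntro _ _ ih₁ ih₂ =>
    exact .negIntro (ih₁ (Set.insert_subset_insert hΓ)) (ih₂ (Set.insert_subset_insert hΓ))
  | byContradiction _ _ ih₁ ih₂ =>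
    exact .byContradiction (ih₁ (Set.insert_subset_insert hΓ)) (ih₂ (Set.insert_subset_insert hΓ))
  | allIntro _ ih => exact .allIntro (ih (Set.image_mono hΓ))
  | allElim t _ ih => exact .allElim t (ih hΓ)
  | eqRefl t => exact .eqRefl t
  | eqSubst φ _ _ ih₁ ih₂ => exact .eqSubst φ (ih₁ hΓ) (ih₂ hΓ)

/-- This is what permits renaming a fresh variable in a derivation. Below a quantifier introduction
the hypothesis is used for `up σ`, which commutes with the shift of the assumptions. -/
theorem Derives.subst {Γ : Set Formula} {φ : Formula} (h : Derives Γ φ) (σ : ℕ → Term) :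
    Derives (Formula.subst σ '' Γ) (φ.subst σ) := by
  induction h generalizing σ with
  | assumption h => exact .assumption (Set.mem_image_of_mem _ h)
  | impIntro _ ih => exact .impIntro (by simpa [Set.image_insert_eq] using ih σ)
  | impElim _ _ ih₁ ih₂ => exact .impElim (ih₁ σ) (ih₂ σ)
  | negIntro _ _ ih₁ ih₂ =>
    exact .negIntro (by simpa [Set.image_insert_eq] using ih₁ σ)
      (by simpa [Set.image_insert_eq, Formula.subst] using ih₂ σ)
  | byContradiction _ _ ih₁ ih₂ =>
    exact .byContradiction (by simpa [Set.image_insert_eq, Formula.subst] using ih₁ σ)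
      (by simpa [Set.image_insert_eq, Formula.subst] using ih₂ σ)
  | allIntro _ ih =>
    refine .allIntro ?_
    simpa [Set.image_image, Formula.shift_subst_up] using ih (up σ)
  | allElim t _ ih =>
    rw [Formula.app_subst]
    exact .allElim _ (ih σ)
  | eqRefl t => exact .eqRefl _
  | eqSubst φ _ _ ih₁ ih₂ =>
    rw [Formula.app_subst]
    exact .eqSubst _ (ih₁ σ) (by simpa [Formula.app_subst] using ih₂ σ)

theorem subset_insert_diff_singleton {α : Type*} (a : α) (s : Set α) : s ⊆ insert a (s \ {a}) := by
  intro b hb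
  by_cases h : b = a <;> simp_all

/-- A derivation is a finite tree and uses finitely many assumptions. This makes the union of a
chain of consistent sets consistent. -/
theorem Derives.exists_finite {Γ : Set Formula} {φ : Formula} (h : Derives Γ φ) :
    ∃ Δ ⊆ Γ, Δ.Finite ∧ Derives Δ φ := by
  induction h with
  | @assumption Γ φ h =>
    exact ⟨{φ}, by simpa using h, Set.finite_singleton _, .assumption rfl⟩
  | @impIntro Γ φ ψ _ ih =>
    obtain ⟨Δ, hΔ, hf, hd⟩ := ih
    exact ⟨Δ \ {φ}, by simpa using hΔ, hf.sdiff,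
      .impIntro (hd.mono (subset_insert_diff_singleton _ _))⟩
  | impElim _ _ ih₁ ih₂ =>
    obtain ⟨Δ₁, hΔ₁, hf₁, hd₁⟩ := ih₁
    obtain ⟨Δ₂, hΔ₂, hf₂, hd₂⟩ := ih₂
    exact ⟨Δ₁ ∪ Δ₂, Set.union_subset hΔ₁ hΔ₂, hf₁.union hf₂,
      .impElim (hd₁.mono Set.subset_union_left) (hd₂.mono Set.subset_union_right)⟩
  | @negIntro Γ φ ψ _ _ ih₁ ih₂ =>
    obtain ⟨Δ₁, hΔ₁, hf₁, hd₁⟩ := ih₁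
    obtain ⟨Δ₂, hΔ₂, hf₂, hd₂⟩ := ih₂
    have h := subset_insert_diff_singleton φ (Δ₁ ∪ Δ₂)
    exact ⟨(Δ₁ ∪ Δ₂) \ {φ}, by simpa using ⟨hΔ₁, hΔ₂⟩, (hf₁.union hf₂).sdiff,
      .negIntro (hd₁.mono (Set.subset_union_left.trans h))
        (hd₂.mono (Set.subset_union_right.trans h))⟩
  | @byContradiction Γ φ ψ _ _ ih₁ ih₂ =>
    obtain ⟨Δ₁, hΔ₁, hf₁, hd₁⟩ := ih₁
    obtain ⟨Δ₂, hΔ₂, hf₂, hd₂⟩ := ih₂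
    have h := subset_insert_diff_singleton φ.neg (Δ₁ ∪ Δ₂)
    exact ⟨(Δ₁ ∪ Δ₂) \ {φ.neg}, by simpa using ⟨hΔ₁, hΔ₂⟩, (hf₁.union hf₂).sdiff,
      .byContradiction (hd₁.mono (Set.subset_union_left.trans h))
        (hd₂.mono (Set.subset_union_right.trans h))⟩
  | allIntro _ ih =>
    obtain ⟨Δ, hΔ, hf, hd⟩ := ih
    obtain ⟨Δ', hΔ', hf', rfl⟩ := Set.exists_subset_image_finite_and.1 ⟨Δ, hΔ, hf, rfl⟩
    exact ⟨Δ', hΔ', hf', .allIntro hd⟩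
  | allElim t _ ih =>
    obtain ⟨Δ, hΔ, hf, hd⟩ := ih
    exact ⟨Δ, hΔ, hf, .allElim t hd⟩
  | eqRefl t => exact ⟨∅, by simp, by simp, .eqRefl t⟩
  | eqSubst φ _ _ ih₁ ih₂ =>
    obtain ⟨Δ₁, hΔ₁, hf₁, hd₁⟩ := ih₁
    obtain ⟨Δ₂, hΔ₂, hf₂, hd₂⟩ := ih₂
    exact ⟨Δ₁ ∪ Δ₂, Set.union_subset hΔ₁ hΔ₂, hf₁.union hf₂,
      .eqSubst φ (hd₁.mono Set.subset_union_left) (hd₂.mono Set.subset_union_right)⟩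

/-- Generalization on a variable that is not free in the assumptions. -/
theorem Derives.all_of_fresh {Γ : Set Formula} {φ : Formula} {k : ℕ} (hΓ : ∀ ψ ∈ Γ, ψ.ClosedAt k)
    (hφ : φ.ClosedAt (k + 1)) (h : Derives Γ (φ.app [.var k])) : Derives Γ φ.all := by
  refine .allIntro ?_
  -- This renaming sends `k` to the variable about to be bound and shifts the others. On variables
  -- below `k` it is the shift, and it undoes the instantiation of `φ` at `k`.
  have h := h.subst fun i => if i = k then .var 0 else .var (i + 1)
  have e₁ : Formula.subst (fun i => if i = k then .var 0 else .var (i + 1)) '' Γ =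
      Formula.shift '' Γ :=
    Set.image_congr fun ψ hψ => Formula.subst_congr (fun i hi => by simp [hi.ne]) (hΓ ψ hψ)
  have e₂ : (φ.app [.var k]).subst (fun i => if i = k then .var 0 else .var (i + 1)) = φ := by
    conv_rhs => rw [← φ.subst_var]
    rw [Formula.app_singleton, Formula.subst_subst]
    refine Formula.subst_congr (fun i hi => ?_) hφ
    cases i with
    | zero => simp [Term.subst]
    | succ i => simp [Term.subst, show i ≠ k by omega]
  rwa [e₁, e₂] at h

/-! ### Codes -/

/-- Unique readability of prefix notation. The arbitrary remainders `l` and `m` are what lets the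
induction pass from the first argument of a binary symbol to the second. -/
theorem Term.string_append_inj {s t : Term} {l m : List Letter}
    (h : s.string ++ l = t.string ++ m) : s = t ∧ l = m := by
  induction s generalizing t l m with
  | var i =>
    cases t with
    | var j =>
      simp only [Term.string] at h
      induction i generalizing j with
      | zero => cases j <;> simp_all [List.replicate_succ]
      | succ i ih =>
        cases j with
        | zero => simp [List.replicate_succ] at h
        | succ j =>
          have := ih (j := j) (by simpa [List.replicate_succ] using h)
          simp_all
    | _ => cases i <;> simp [Term.string, List.replicate_succ] at h
  | zero =>
    cases t with
    | var j => cases j <;> simp [Term.string, List.replicate_succ] at h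
    | zero => simpa [Term.string] using h
    | _ => simp [Term.string] at h
  | succ s ih =>
    cases t with
    | var j => cases j <;> simp [Term.string, List.replicate_succ] at h
    | succ t =>
      have := ih (t := t) (by simpa [Term.string] using h)
      simp_all
    | _ => simp [Term.string] at h
  | add s₁ s₂ ih₁ ih₂ =>
    cases t with
    | var j => cases j <;> simp [Term.string, List.replicate_succ] at h
    | add t₁ t₂ =>
      obtain ⟨rfl, h₁⟩ := ih₁ (t := t₁) (by simpa [Term.string] using h)
      obtain ⟨rfl, h₂⟩ := ih₂ h₁
      exact ⟨rfl, h₂⟩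
    | _ => simp [Term.string] at h
  | mul s₁ s₂ ih₁ ih₂ =>
    cases t with
    | var j => cases j <;> simp [Term.string, List.replicate_succ] at h
    | mul t₁ t₂ =>
      obtain ⟨rfl, h₁⟩ := ih₁ (t := t₁) (by simpa [Term.string] using h)
      obtain ⟨rfl, h₂⟩ := ih₂ h₁
      exact ⟨rfl, h₂⟩
    | _ => simp [Term.string] at h

theorem Formula.string_append_inj {φ ψ : Formula} {l m : List Letter}
    (h : φ.string ++ l = ψ.string ++ m) : φ = ψ ∧ l = m := by
  induction φ generalizing ψ l m with
  | eq s t =>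
    cases ψ with
    | eq s' t' =>
      obtain ⟨rfl, h₁⟩ := Term.string_append_inj (s := s) (t := s')
        (by simpa [Formula.string] using h)
      obtain ⟨rfl, h₂⟩ := Term.string_append_inj h₁
      exact ⟨rfl, h₂⟩
    | _ => simp [Formula.string] at h
  | neg φ ih =>
    cases ψ with
    | neg ψ =>
      obtain ⟨rfl, h₁⟩ := ih (ψ := ψ) (by simpa [Formula.string] using h)
      exact ⟨rfl, h₁⟩
    | _ => simp [Formula.string] at h
  | imp φ₁ φ₂ ih₁ ih₂ =>
    cases ψ with
    | imp ψ₁ ψ₂ =>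
      obtain ⟨rfl, h₁⟩ := ih₁ (ψ := ψ₁) (by simpa [Formula.string] using h)
      obtain ⟨rfl, h₂⟩ := ih₂ h₁
      exact ⟨rfl, h₂⟩
    | _ => simp [Formula.string] at h
  | all φ ih =>
    cases ψ with
    | all ψ =>
      obtain ⟨rfl, h₁⟩ := ih (ψ := ψ) (by simpa [Formula.string] using h)
      exact ⟨rfl, h₁⟩
    | _ => simp [Formula.string] at h

theorem Formula.string_injective : Function.Injective Formula.string := fun φ ψ h =>
  (string_append_inj (l := []) (m := []) (by simpa using h)).1

theorem foldl_digit (l : List Letter) (n : ℕ) :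
    l.foldl (fun n a => 10 * n + a.digit) n = n * 10 ^ l.length + stringNumber l := by
  unfold stringNumber
  induction l generalizing n with
  | nil => simp
  | cons a l ih =>
    simp only [List.foldl_cons, List.length_cons]
    rw [ih, ih (10 * 0 + _)]
    ring

theorem stringNumber_append (l m : List Letter) :
    stringNumber (l ++ m) = stringNumber l * 10 ^ m.length + stringNumber m := by
  rw [stringNumber, List.foldl_append, foldl_digit]
  rfl

theorem stringNumber_cons (a : Letter) (l : List Letter) :
    stringNumber (a :: l) = a.digit * 10 ^ l.length + stringNumber l := by
  simpa [stringNumber] using stringNumber_append [a] l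

theorem Letter.digit_lt (a : Letter) : a.digit < 10 := by cases a <;> decide

theorem Letter.digit_injective : Function.Injective Letter.digit := by
  intro a b h
  cases a <;> cases b <;> first | rfl | simp [Letter.digit] at h

theorem stringNumber_lt (l : List Letter) : stringNumber l < 10 ^ l.length := by
  induction l with
  | nil => simp [stringNumber]
  | cons a l ih =>
    rw [stringNumber_cons, List.length_cons, pow_succ]
    have := a.digit_lt
    nlinarith

theorem stringNumber_inj_of_length_eq {l m : List Letter} (hl : l.length = m.length)
    (h : stringNumber l = stringNumber m) : l = m := by
  induction l generalizing m with
  | nil => exact (List.length_eq_zero_iff.1 hl.symm).symm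
  | cons a l ih =>
    cases m with
    | nil => simp at hl
    | cons b m =>
      have hlm : l.length = m.length := by simpa using hl
      rw [stringNumber_cons, stringNumber_cons, hlm] at h
      have hl' := stringNumber_lt l
      have hm' := stringNumber_lt m
      rw [hlm] at hl'
      have key : ∀ d r : ℕ, r < 10 ^ m.length → (d * 10 ^ m.length + r) / 10 ^ m.length = d :=
        fun d r hr => by
          rw [mul_comm, Nat.mul_add_div (by positivity), Nat.div_eq_of_lt hr, add_zero]
      have hd := congrArg (· / 10 ^ m.length) h
      simp only [key _ _ hl', key _ _ hm'] at hd
      obtain rfl := Letter.digit_injective hd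
      rw [ih hlm (by simpa using h)]

/-- The stroke is the digit zero, so a number determines its string only once the length is known.
Since no formula begins with a stroke, the length can be read off from the logarithm. -/
theorem Formula.exists_string_eq (φ : Formula) :
    ∃ (a : Letter) (l : List Letter), φ.string = a :: l ∧ a.digit ≠ 0 := by
  cases φ <;> exact ⟨_, _, rfl, by decide⟩

theorem Formula.log_code (φ : Formula) : Nat.log 10 φ.code + 1 = φ.string.length := by
  obtain ⟨a, l, h, ha⟩ := φ.exists_string_eq
  rw [Formula.code, h, List.length_cons]
  congr 1
  refine Nat.log_eq_of_pow_le_of_lt_pow ?_ (by simpa using stringNumber_lt (a :: l))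
  rw [stringNumber_cons]
  have := Nat.one_le_iff_ne_zero.2 ha
  nlinarith [Nat.pow_pos (n := l.length) (show 0 < 10 by norm_num)]

theorem Formula.code_injective : Function.Injective Formula.code := fun φ ψ h =>
  string_injective (stringNumber_inj_of_length_eq (by rw [← log_code, ← log_code, h]) h)

theorem Formula.cat_negCode (φ : Formula) : cat negCode φ.code = φ.neg.code := by
  rw [cat, log_code, negCode, code, code, ← stringNumber_append]
  rfl

instance : Nonempty Formula := ⟨.eq .zero .zero⟩

instance : Countable Formula := Formula.code_injective.countable

/-! ### Completeness -/

/-- No formula is derivable together with its negation. -/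
def DerivationConsistent (Γ : Set Formula) : Prop :=
  ¬ ∃ φ, Derives Γ φ ∧ Derives Γ φ.neg

/-- All free variables of formulas in the set are below a common bound. -/
def BoundedVars (Γ : Set Formula) : Prop := ∃ k, ∀ φ ∈ Γ, φ.ClosedAt k

theorem BoundedVars.insert {Γ : Set Formula} (h : BoundedVars Γ) (φ : Formula) :
    BoundedVars (insert φ Γ) := by
  obtain ⟨k, hk⟩ := h
  obtain ⟨n, hn⟩ := φ.exists_closedAt
  refine ⟨max k n, ?_⟩
  rintro ψ (rfl | hψ)
  exacts [hn.mono (le_max_right ..), (hk ψ hψ).mono (le_max_left ..)]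

theorem derives_neg_of_not_consistent {Γ : Set Formula} {φ : Formula}
    (h : ¬ DerivationConsistent (insert φ Γ)) : Derives Γ φ.neg := by
  obtain ⟨ψ, h₁, h₂⟩ := not_not.1 h
  exact .negIntro h₁ h₂

theorem derives_of_not_consistent {Γ : Set Formula} {φ : Formula}
    (h : ¬ DerivationConsistent (insert φ.neg Γ)) : Derives Γ φ := by
  obtain ⟨ψ, h₁, h₂⟩ := not_not.1 h
  exact .byContradiction h₁ h₂

/-- The set decides the formula, and has a witness for it if it is refuted and universal. -/
def Settles (Γ : Set Formula) (φ : Formula) : Prop :=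
  φ ∈ Γ ∨ φ.neg ∈ Γ ∧ ∀ χ : Formula, φ = χ.all → ∃ t, (χ.app [t]).neg ∈ Γ

/-- If neither `φ` nor its negation could be added, `Γ` would be inconsistent. For a refuted `∀ χ`
the witness is a variable `k` beyond all free variables in use: if adding `¬ χ(k)` were
inconsistent, `χ(k)` and hence, by generalization, `∀ χ` would be derivable. The bound on free
variables guarantees such a `k` and survives each step. -/
theorem exists_settles {Γ : Set Formula} (hb : BoundedVars Γ) (hc : DerivationConsistent Γ)
    (φ : Formula) :
    ∃ Δ, Γ ⊆ Δ ∧ BoundedVars Δ ∧ DerivationConsistent Δ ∧ Settles Δ φ := by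
  by_cases h : DerivationConsistent (insert φ Γ)
  · exact ⟨_, Set.subset_insert _ _, hb.insert φ, h, .inl (Set.mem_insert _ _)⟩
  have h' : DerivationConsistent (insert φ.neg Γ) := fun h' => by
    have h₁ := derives_neg_of_not_consistent h
    have h₂ := derives_of_not_consistent (not_not.2 h')
    exact hc ⟨_, h₂, h₁⟩
  by_cases hφ : ∃ χ : Formula, φ = χ.all
  · obtain ⟨χ, rfl⟩ := hφ
    obtain ⟨k, hk⟩ := hb.insert χ.all.neg
    have hχ : χ.ClosedAt (k + 1) := hk _ (Set.mem_insert _ _)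
    refine ⟨insert (χ.app [.var k]).neg (insert χ.all.neg Γ),
      (Set.subset_insert _ _).trans (Set.subset_insert _ _), (hb.insert _).insert _,
      fun h₂ => ?_, .inr ⟨by simp, ?_⟩⟩
    · have h₃ := (derives_of_not_consistent (not_not.2 h₂)).all_of_fresh hk hχ
      exact h' ⟨_, h₃, .assumption (Set.mem_insert _ _)⟩
    · rintro _ ⟨⟩
      exact ⟨_, Set.mem_insert _ _⟩
  · exact ⟨_, Set.subset_insert _ _, hb.insert _, h', .inr ⟨Set.mem_insert _ _,
      fun χ hχ => (hφ ⟨χ, hχ⟩).elim⟩⟩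

/-- Formulas are settled one by one along an enumeration. A contradiction in the union would already
occur at a finite stage. The union need not have bounded variables, but no fresh ones are needed any
more. -/
theorem exists_henkin {Γ : Set Formula} (hb : BoundedVars Γ) (hc : DerivationConsistent Γ) :
    ∃ Δ, Γ ⊆ Δ ∧ DerivationConsistent Δ ∧ ∀ φ, Settles Δ φ := by
  obtain ⟨e, he⟩ := exists_surjective_nat Formula
  choose next h_sub h_bd h_con h_set using
    fun (Δ : {Δ : Set Formula // BoundedVars Δ ∧ DerivationConsistent Δ}) (φ : Formula) =>
      exists_settles Δ.2.1 Δ.2.2 φ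
  let s : ℕ → {Δ : Set Formula // BoundedVars Δ ∧ DerivationConsistent Δ} := fun n =>
    n.rec ⟨Γ, hb, hc⟩ fun n Δ => ⟨next Δ (e n), h_bd Δ (e n), h_con Δ (e n)⟩
  have h_mono : Monotone fun n => (s n).1 := monotone_nat_of_le_succ fun n => h_sub (s n) (e n)
  refine ⟨⋃ n, (s n).1, Set.subset_iUnion (fun n => (s n).1) 0, ?_, fun φ => ?_⟩
  · have key : ∀ φ, Derives (⋃ n, (s n).1) φ → ∃ n, Derives (s n).1 φ := by
      intro φ hφ
      obtain ⟨Δ, hΔ, hf, hd⟩ := hφ.exists_finite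
      lift Δ to Finset Formula using hf
      obtain ⟨n, hn⟩ := h_mono.directed_le.exists_mem_subset_of_finset_subset_biUnion hΔ
      exact ⟨n, hd.mono hn⟩
    rintro ⟨φ, h₁, h₂⟩
    obtain ⟨n, hn⟩ := key _ h₁
    obtain ⟨m, hm⟩ := key _ h₂
    exact (s (max n m)).2.2 ⟨φ, hn.mono (h_mono (le_max_left ..)),
      hm.mono (h_mono (le_max_right ..))⟩
  · obtain ⟨n, rfl⟩ := he φ
    have h_le : next (s n) (e n) ⊆ ⋃ n, (s n).1 := Set.subset_iUnion (fun n => (s n).1) (n + 1)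
    rcases h_set (s n) (e n) with h | ⟨h₁, h₂⟩
    · exact .inl (h_le h)
    · exact .inr ⟨h_le h₁, fun χ hχ => (h₂ χ hχ).imp fun t ht => h_le ht⟩

/-! ### Equality and the term model -/

theorem Derives.eq_symm {Γ : Set Formula} {s t : Term} (h : Derives Γ (.eq s t)) :
    Derives Γ (.eq t s) := by
  -- The shifted side of the equation is not affected by the substitution for variable `0`. The same
  -- device yields transitivity and congruence.
  have := Derives.eqSubst (.eq (.var 0) s.shift) h
  simp only [Formula.app_singleton, Formula.subst, Term.subst, Term.shift_subst_cons, cons_zero,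
    Term.subst_var] at this
  exact this (.eqRefl s)

theorem Derives.eq_trans {Γ : Set Formula} {s t u : Term} (h₁ : Derives Γ (.eq s t))
    (h₂ : Derives Γ (.eq t u)) : Derives Γ (.eq s u) := by
  have := Derives.eqSubst (.eq s.shift (.var 0)) h₂
  simp only [Formula.app_singleton, Formula.subst, Term.subst, Term.shift_subst_cons, cons_zero,
    Term.subst_var] at this
  exact this h₁

theorem Derives.eq_congr {Γ : Set Formula} {s t : Term} (u : Term) (h : Derives Γ (.eq s t)) :
    Derives Γ (.eq (u.subst (cons s .var)) (u.subst (cons t .var))) := by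
  have := Derives.eqSubst (.eq (u.subst (cons s .var)).shift u) h
  simp only [Formula.app_singleton, Formula.subst, Term.shift_subst_cons, Term.subst_var] at this
  exact this (.eqRefl _)

theorem Derives.eq_succ {Γ : Set Formula} {s t : Term} (h : Derives Γ (.eq s t)) :
    Derives Γ (.eq s.succ t.succ) := h.eq_congr (.succ (.var 0))

theorem Derives.eq_add {Γ : Set Formula} {s t s' t' : Term} (h : Derives Γ (.eq s t))
    (h' : Derives Γ (.eq s' t')) : Derives Γ (.eq (s.add s') (t.add t')) := by
  have h₁ := h.eq_congr (.add (.var 0) s'.shift)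
  have h₂ := h'.eq_congr (.add t.shift (.var 0))
  simp only [Term.subst, Term.shift_subst_cons, cons_zero, Term.subst_var] at h₁ h₂
  exact h₁.eq_trans h₂

theorem Derives.eq_mul {Γ : Set Formula} {s t s' t' : Term} (h : Derives Γ (.eq s t))
    (h' : Derives Γ (.eq s' t')) : Derives Γ (.eq (s.mul s') (t.mul t')) := by
  have h₁ := h.eq_congr (.mul (.var 0) s'.shift)
  have h₂ := h'.eq_congr (.mul t.shift (.var 0))
  simp only [Term.subst, Term.shift_subst_cons, cons_zero, Term.subst_var] at h₁ h₂
  exact h₁.eq_trans h₂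

/-- Derivable equality of terms. -/
def termSetoid (Γ : Set Formula) : Setoid Term where
  r s t := Derives Γ (.eq s t)
  iseqv := ⟨fun t => .eqRefl t, fun h => h.eq_symm, fun h₁ h₂ => h₁.eq_trans h₂⟩

/-- Terms modulo derivable equality. -/
def TermModel (Γ : Set Formula) : Type := Quotient (termSetoid Γ)

/-- The class of a term in the term model. -/
def TermModel.mk (Γ : Set Formula) (t : Term) : TermModel Γ := Quotient.mk (termSetoid Γ) t

instance (Γ : Set Formula) : ArithStructure (TermModel Γ) where
  zero := .mk Γ .zero
  succ := Quotient.map .succ fun _ _ h => h.eq_succ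
  add := Quotient.map₂ .add fun _ _ h _ _ h' => Derives.eq_add h h'
  mul := Quotient.map₂ .mul fun _ _ h _ _ h' => Derives.eq_mul h h'

theorem TermModel.val_eq (Γ : Set Formula) (σ : ℕ → Term) (t : Term) :
    t.val (fun i => mk Γ (σ i)) = mk Γ (t.subst σ) := by
  induction t with
  | var i => rfl
  | zero => rfl
  | succ t ih => exact congrArg ArithStructure.succ ih
  | add s t ih₁ ih₂ => exact congrArg₂ ArithStructure.add ih₁ ih₂
  | mul s t ih₁ ih₂ => exact congrArg₂ ArithStructure.mul ih₁ ih₂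

/-- Since every formula is settled, derivability commutes with negation and implication, and the
witnesses handle the universal quantifier. The substitution `σ` is arbitrary because an element
chosen for a quantifier is the class of some term. -/
theorem TermModel.sat_iff {Γ : Set Formula} (hc : DerivationConsistent Γ)
    (hs : ∀ φ, Settles Γ φ) (φ : Formula) (σ : ℕ → Term) :
    φ.Sat (fun i => mk Γ (σ i)) ↔ Derives Γ (φ.subst σ) := by
  have hneg : ∀ φ : Formula, Derives Γ φ.neg ↔ ¬ Derives Γ φ := fun φ =>
    ⟨fun h h' => hc ⟨φ, h', h⟩, fun h => (hs φ).elim (fun h' => (h (.assumption h')).elim)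
      fun h' => .assumption h'.1⟩
  induction φ generalizing σ with
  | eq s t =>
    rw [sat_eq, val_eq, val_eq]
    exact Quotient.eq (r := termSetoid Γ)
  | neg φ ih => exact (not_congr (ih σ)).trans (hneg _).symm
  | imp φ ψ ih₁ ih₂ =>
    refine (imp_congr (ih₁ σ) (ih₂ σ)).trans ?_
    refine ⟨fun h => .impIntro ?_, fun h h' => h.impElim h'⟩
    by_cases hφ : Derives Γ (φ.subst σ)
    · exact (h hφ).mono (Set.subset_insert _ _)
    · exact .byContradiction
        (.assumption (Set.mem_insert_of_mem _ (Set.mem_insert _ _)))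
        (((hneg _).2 hφ).mono ((Set.subset_insert _ _).trans (Set.subset_insert _ _)))
  | all φ ih =>
    have key : ∀ t, φ.Sat (cons (mk Γ t) fun i => mk Γ (σ i)) ↔
        Derives Γ ((φ.subst (up σ)).app [t]) := fun t => by
      rw [← comp_cons (mk Γ), Formula.subst_up_app]
      exact ih _
    rw [sat_all, Formula.subst]
    constructor
    · intro h
      rcases hs (φ.subst (up σ)).all with h' | ⟨-, h'⟩
      · exact .assumption h'
      · obtain ⟨t, ht⟩ := h' _ rfl
        exact (hc ⟨_, (key t).1 (h _), .assumption ht⟩).elim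
    · intro h a
      obtain ⟨t, rfl⟩ : ∃ t, mk Γ t = a := Quotient.exists_rep a
      exact (key t).2 (h.allElim t)

/-- Completeness, for theories in the language of arithmetic. -/
theorem IsTheory.mem_of_forall_sat {T : Set Formula} (hT : IsTheory T) {A : Formula}
    (hA : A.IsSentence)
    (h : ∀ (M : Type) [ArithStructure M], (∀ B ∈ T, ∀ v : ℕ → M, B.Sat v) →
      ∃ v : ℕ → M, A.Sat v) : A ∈ T := by
  by_contra hAT
  have hc : DerivationConsistent (insert A.neg T) := fun h' =>
    hAT (hT.2 A hA (derives_of_not_consistent (not_not.2 h')))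
  obtain ⟨Γ, hΓ, hcΓ, hs⟩ := exists_henkin (BoundedVars.insert ⟨0, hT.1⟩ A.neg) hc
  have key : ∀ B ∈ insert A.neg T, ∀ v : ℕ → TermModel Γ, B.Sat v := by
    intro B hB v
    have hB' : B.IsSentence := by
      rcases hB with rfl | hB
      exacts [hA, hT.1 B hB]
    rw [hB'.sat_congr (w := fun i => TermModel.mk Γ (.var i)), TermModel.sat_iff hcΓ hs,
      hB'.subst]
    exact .assumption (hΓ hB)
  obtain ⟨v, hv⟩ := h (TermModel Γ) fun B hB => key B (Set.mem_insert_of_mem _ hB)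
  exact key _ (Set.mem_insert _ _) v hv

/-! ### Models of Peano arithmetic -/

section

open ArithStructure

/-- The structure satisfies the axioms of Peano arithmetic. -/
class PAModel (M : Type) [ArithStructure M] : Prop where
  succ_ne_zero : ∀ x : M, succ x ≠ zero
  succ_inj : ∀ x y : M, succ x = succ y → x = y
  zero_or_succ : ∀ x : M, x = zero ∨ ∃ y, succ y = x
  add_zero : ∀ x : M, add x zero = x
  add_succ : ∀ x y : M, add x (succ y) = succ (add x y)
  mul_zero : ∀ x : M, mul x zero = zero
  mul_succ : ∀ x y : M, mul x (succ y) = add x (mul x y)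
  induction : ∀ (φ : Formula) (v : ℕ → M), φ.Sat (cons zero v) →
    (∀ a, φ.Sat (cons a v) → φ.Sat (cons (succ a) v)) → ∀ a, φ.Sat (cons a v)

instance : PAModel ℕ where
  succ_ne_zero := Nat.succ_ne_zero
  succ_inj _ _ := Nat.succ.inj
  zero_or_succ x := by cases x; exacts [.inl rfl, .inr ⟨_, rfl⟩]
  add_zero _ := rfl
  add_succ _ _ := rfl
  mul_zero _ := rfl
  mul_succ x y := (Nat.mul_succ x y).trans (Nat.add_comm _ _)
  induction φ v h₀ h a := Nat.rec h₀ h a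

theorem sat_of_sat_allN {M : Type} [ArithStructure M] {φ : Formula} {n : ℕ} {v : ℕ → M}
    (h : (φ.allN n).Sat v) {w : ℕ → M} (hw : ∀ i, w (i + n) = v i) : φ.Sat w := by
  induction n generalizing v with
  | zero =>
    rwa [show w = v from funext hw]
  | succ n ih =>
    refine ih (h (w n)) fun i => ?_
    cases i with
    | zero => simp
    | succ i => rw [cons_succ, ← hw i]; congr 1; omega

theorem Formula.ClosedAt.allN {φ : Formula} {m n : ℕ} (h : φ.ClosedAt (m + n)) :
    (φ.allN n).ClosedAt m := by
  induction n generalizing m with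
  | zero => exact h
  | succ n ih => exact ih (m := m + 1) (by rwa [Nat.add_right_comm])

theorem RobinsonAxiom.isSentence {A : Formula} (h : RobinsonAxiom A) : A.IsSentence := by
  cases h <;>
    simp [Formula.IsSentence, Formula.ClosedAt, Term.ClosedAt, Formula.or, Formula.ex]

theorem paAxioms_subset_PA : PAAxioms ⊆ PA := by
  intro A hA
  refine ⟨?_, .assumption hA⟩
  rcases hA with hA | hA
  exacts [hA.isSentence, hA.1]

theorem PAModel.of_sat {M : Type} [ArithStructure M]
    (h : ∀ A ∈ PAAxioms, ∀ v : ℕ → M, A.Sat v) : PAModel M := by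
  have hR : ∀ A, RobinsonAxiom A → A.Sat fun _ : ℕ => (zero : M) := fun A hA => h A (.inl hA) _
  constructor
  · simpa [Term.val] using hR _ .s0
  · simpa [Term.val] using hR _ .s1
  · simpa [Term.val] using hR _ .s2
  · simpa [Term.val] using hR _ .a0
  · simpa [Term.val] using hR _ .a1
  · simpa [Term.val] using hR _ .m0
  · simpa [Term.val] using hR _ .m1
  · intro φ v h₀ hs
    obtain ⟨n, hn⟩ := φ.induction.exists_closedAt
    have hA := h (φ.induction.allN n)
      (.inr ⟨Formula.ClosedAt.allN (by simpa using hn), n, φ, rfl⟩) fun i => v (i + n - n - n)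
    -- The assignment `w` agrees with `v` on the variables below `n`, the only free ones of the
    -- induction axiom. Its values from `n` on are irrelevant and merely match the assignment chosen
    -- for the closure.
    have := sat_of_sat_allN (w := fun i => if i < n then v i else v (i - n - n)) hA fun i => by
      simp
    rw [hn.sat_congr (w := v) fun i hi => by simp [hi]] at this
    simp only [Formula.induction, sat_imp, sat_and, sat_app, sat_all, sat_subst, List.foldr,
      Term.val] at this
    refine this ⟨h₀, fun a ha => ?_⟩
    rw [cons_ext (v := fun i => Term.val (cons a v)
      (if i = 0 then (Term.var 0).succ else Term.var i)) (a := succ a) (w := v) (by simp [Term.val])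
      (by simp [Term.val])]
    exact hs a ha

/-- The value of the numeral of `n`. -/
def emb {M : Type} [ArithStructure M] : ℕ → M
  | 0 => zero
  | n + 1 => succ (emb n)

/-- The ordering. -/
def Lt {M : Type} [ArithStructure M] (a b : M) : Prop := ∃ z, add a (succ z) = b

/-- The formula `s < t`. -/
def Formula.lt (s t : Term) : Formula := .ex (.eq (.add s.shift (.succ (.var 0))) t.shift)

@[simp] theorem sat_lt {M : Type} [ArithStructure M] (v : ℕ → M) (s t : Term) :
    (Formula.lt s t).Sat v ↔ Lt (s.val v) (t.val v) := by
  simp [Formula.lt, Term.val, Lt]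

@[simp] theorem val_num {M : Type} [ArithStructure M] (v : ℕ → M) (n : ℕ) :
    (num n).val v = emb n := by
  induction n with
  | zero => rfl
  | succ n ih => exact congrArg succ ih

theorem emb_nat (n : ℕ) : emb n = n := by
  induction n with
  | zero => rfl
  | succ n ih => exact congrArg (· + 1) ih

namespace PAModel

variable {M : Type} [ArithStructure M] [PAModel M]

theorem zero_add (a : M) : add zero a = a := by
  have := PAModel.induction (.eq (.add .zero (.var 0)) (.var 0)) (fun _ => a)
  simp only [sat_eq, Term.val, cons_zero] at this
  exact this (add_zero _) (fun b hb => by rw [add_succ, hb]) a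

theorem succ_add (a b : M) : add (succ a) b = succ (add a b) := by
  have := PAModel.induction (.eq (.add (.succ (.var 1)) (.var 0)) (.succ (.add (.var 1) (.var 0))))
    (fun _ => a)
  simp only [sat_eq, Term.val, cons_zero, cons_one] at this
  exact this (by rw [add_zero, add_zero]) (fun b hb => by rw [add_succ, add_succ, hb]) b

/-- Induction on `a` inside the model. Together with the two preceding lemmas, which serve this one,
it is all that is used of the induction schema. It is needed for possibly nonstandard elements. -/
theorem lt_trichotomy (a b : M) : Lt a b ∨ a = b ∨ Lt b a := by
  have := PAModel.induction
    (.or (.lt (.var 0) (.var 1)) (.or (.eq (.var 0) (.var 1)) (.lt (.var 1) (.var 0))))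
    (fun _ => b)
  simp only [sat_or, sat_lt, sat_eq, Term.val, cons_zero, cons_one] at this
  refine this ?_ ?_ a
  · rcases zero_or_succ b with rfl | ⟨c, rfl⟩
    · exact .inr (.inl rfl)
    · exact .inl ⟨c, zero_add _⟩
  · rintro a (⟨z, rfl⟩ | rfl | ⟨z, rfl⟩)
    · rcases zero_or_succ z with rfl | ⟨c, rfl⟩
      · exact .inr (.inl (by rw [add_succ, add_zero]))
      · exact .inl ⟨c, by rw [succ_add, add_succ a (succ c)]⟩
    · exact .inr (.inr ⟨zero, by rw [add_succ, add_zero]⟩)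
    · exact .inr (.inr ⟨succ z, by rw [add_succ]⟩)

theorem emb_add (m n : ℕ) : (emb (m + n) : M) = add (emb m) (emb n) := by
  induction n with
  | zero => exact (add_zero _).symm
  | succ n ih => exact (congrArg succ ih).trans (add_succ _ _).symm

theorem emb_mul (m n : ℕ) : (emb (m * n) : M) = mul (emb m) (emb n) := by
  induction n with
  | zero => exact (mul_zero _).symm
  | succ n ih => rw [Nat.mul_succ, Nat.add_comm, emb_add, ih, emb, mul_succ]

theorem emb_inj {m n : ℕ} : (emb m : M) = emb n ↔ m = n := by
  refine ⟨fun h => ?_, fun h => h ▸ rfl⟩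
  induction m generalizing n with
  | zero =>
    cases n with
    | zero => rfl
    | succ n => exact (succ_ne_zero _ h.symm).elim
  | succ m ih =>
    cases n with
    | zero => exact (succ_ne_zero _ h).elim
    | succ n => rw [ih (succ_inj _ _ h)]

/-- Standard elements form an initial segment: from `a + S z = n + 1` a successor can be cancelled,
so ordinary induction on `n` reaches `a` after finitely many steps. -/
theorem lt_emb_iff {a : M} {n : ℕ} : Lt a (emb n) ↔ ∃ m < n, a = emb m := by
  constructor
  · rintro ⟨z, hz⟩
    induction n generalizing z with
    | zero => exact (succ_ne_zero _ ((add_succ a z).symm.trans hz)).elim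
    | succ n ih =>
      rw [add_succ] at hz
      have hz := succ_inj _ _ hz
      rcases zero_or_succ z with rfl | ⟨c, rfl⟩
      · exact ⟨n, n.lt_succ_self, (add_zero a).symm.trans hz⟩
      · obtain ⟨m, hm, rfl⟩ := ih c hz
        exact ⟨m, hm.trans n.lt_succ_self, rfl⟩
  · rintro ⟨m, hm, rfl⟩
    obtain ⟨k, rfl⟩ := Nat.exists_eq_add_of_lt hm
    exact ⟨emb k, (emb_add m (k + 1)).symm⟩

theorem val_emb (v : ℕ → ℕ) (t : Term) : t.val (fun i => (emb (v i) : M)) = emb (t.val v) := by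
  induction t with
  | var i => rfl
  | zero => rfl
  | succ t ih => exact congrArg succ ih
  | add s t ih₁ ih₂ => exact (congrArg₂ add ih₁ ih₂).trans (emb_add _ _).symm
  | mul s t ih₁ ih₂ => exact (congrArg₂ mul ih₁ ih₂).trans (emb_mul _ _).symm

end PAModel

end

theorem lt_nat_iff {a b : ℕ} : Lt a b ↔ a < b := by
  have := PAModel.lt_emb_iff (a := a) (n := b)
  simpa [emb_nat] using this

/-! ### Absolute formulas and relations -/

/-- The formula has the same meaning in `ℕ` and in every model of Peano arithmetic. -/
def Formula.Absolute (φ : Formula) : Prop :=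
  ∀ (M : Type) [ArithStructure M] [PAModel M] (v : ℕ → ℕ),
    φ.Sat (fun i => (emb (v i) : M)) ↔ φ.Sat v

/-- The function of an assignment is the value of a term. -/
def IsTerm (f : (ℕ → ℕ) → ℕ) : Prop := ∃ t : Term, ∀ v, t.val v = f v

namespace IsTerm

variable {f g : (ℕ → ℕ) → ℕ}

theorem var (i : ℕ) : IsTerm fun v => v i := ⟨.var i, fun _ => rfl⟩

theorem const (n : ℕ) : IsTerm fun _ => n := ⟨num n, fun v => by rw [val_num, emb_nat]⟩

theorem add (hf : IsTerm f) (hg : IsTerm g) : IsTerm fun v => f v + g v := by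
  obtain ⟨s, hs⟩ := hf
  obtain ⟨t, ht⟩ := hg
  exact ⟨s.add t, fun v => congrArg₂ (· + ·) (hs v) (ht v)⟩

theorem mul (hf : IsTerm f) (hg : IsTerm g) : IsTerm fun v => f v * g v := by
  obtain ⟨s, hs⟩ := hf
  obtain ⟨t, ht⟩ := hg
  exact ⟨s.mul t, fun v => congrArg₂ (· * ·) (hs v) (ht v)⟩

theorem lift (hf : IsTerm f) : IsTerm fun v => f fun i => v (i + 1) := by
  obtain ⟨t, ht⟩ := hf
  exact ⟨t.shift, fun v => (val_subst _ _ _).trans (ht _)⟩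

theorem cons {s : ℕ → (ℕ → ℕ) → ℕ} (hf : IsTerm f) (hs : ∀ i, IsTerm (s i)) :
    ∀ i, IsTerm fun v => PeanoArith.cons (f v) (fun j => s j v) i
  | 0 => hf
  | i + 1 => hs i

end IsTerm

/-- The relation is defined by an absolute formula. -/
def Del (R : (ℕ → ℕ) → Prop) : Prop := ∃ φ : Formula, φ.Absolute ∧ ∀ v : ℕ → ℕ, φ.Sat v ↔ R v

namespace Del

variable {R S : (ℕ → ℕ) → Prop} {Q : ℕ → (ℕ → ℕ) → Prop} {f g : (ℕ → ℕ) → ℕ}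

theorem of_iff (h : Del R) (e : ∀ v, S v ↔ R v) : Del S := by
  rwa [show S = R from funext fun v => propext (e v)]

theorem eq (hf : IsTerm f) (hg : IsTerm g) : Del fun v => f v = g v := by
  obtain ⟨s, hs⟩ := hf
  obtain ⟨t, ht⟩ := hg
  refine ⟨.eq s t, fun M _ _ v => ?_, fun v => by rw [sat_eq, hs, ht]⟩
  rw [sat_eq, sat_eq, PAModel.val_emb, PAModel.val_emb, PAModel.emb_inj]

theorem lt (hf : IsTerm f) (hg : IsTerm g) : Del fun v => f v < g v := by
  obtain ⟨s, hs⟩ := hf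
  obtain ⟨t, ht⟩ := hg
  refine ⟨.lt s t, fun M _ _ v => ?_, fun v => by rw [sat_lt, hs, ht, lt_nat_iff]⟩
  rw [sat_lt, sat_lt, PAModel.val_emb, PAModel.val_emb, PAModel.lt_emb_iff, lt_nat_iff]
  simp [PAModel.emb_inj]

theorem not (hR : Del R) : Del fun v => ¬ R v := by
  obtain ⟨φ, hφ, h⟩ := hR
  exact ⟨φ.neg, fun M _ _ v => not_congr (hφ M v), fun v => not_congr (h v)⟩

theorem imp (hR : Del R) (hS : Del S) : Del fun v => R v → S v := by
  obtain ⟨φ, hφ, h⟩ := hR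
  obtain ⟨ψ, hψ, h'⟩ := hS
  exact ⟨φ.imp ψ, fun M _ _ v => imp_congr (hφ M v) (hψ M v), fun v => imp_congr (h v) (h' v)⟩

theorem and (hR : Del R) (hS : Del S) : Del fun v => R v ∧ S v :=
  (hR.imp hS.not).not.of_iff fun v => by tauto

theorem or (hR : Del R) (hS : Del S) : Del fun v => R v ∨ S v :=
  (hR.not.imp hS).of_iff fun v => by tauto

/-- Below a standard bound a model has only standard elements, so the quantifier ranges over the
same numbers in `M` as in `ℕ`. -/
theorem ball (hf : IsTerm f) (h : Del fun v => Q (v 0) fun i => v (i + 1)) :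
    Del fun v => ∀ a < f v, Q a v := by
  obtain ⟨t, ht⟩ := hf
  obtain ⟨φ, hφ, h⟩ := h
  refine ⟨.all (.imp (.lt (.var 0) t.shift) φ), fun M _ _ v => ?_, fun v => ?_⟩
  · simp only [sat_all, sat_imp, sat_lt, val_shift, Term.val, cons_zero, PAModel.val_emb,
      PAModel.lt_emb_iff, lt_nat_iff]
    constructor
    · intro H a ha
      rw [← hφ M, comp_cons emb]
      exact H _ ⟨a, ha, rfl⟩
    · rintro H _ ⟨a, ha, rfl⟩
      rw [← comp_cons emb, hφ M]
      exact H a ha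
  · simp [Term.val, ht, lt_nat_iff, h]

theorem bex (hf : IsTerm f) (h : Del fun v => Q (v 0) fun i => v (i + 1)) :
    Del fun v => ∃ a < f v, Q a v :=
  (ball (Q := fun a v => ¬ Q a v) hf h.not).not.of_iff fun v => by push Not; rfl

theorem comp (h : Del R) {s : ℕ → (ℕ → ℕ) → ℕ} (hs : ∀ i, IsTerm (s i)) :
    Del fun v => R fun i => s i v := by
  obtain ⟨φ, hφ, h⟩ := h
  choose σ hσ using hs
  refine ⟨φ.subst σ, fun M _ _ v => ?_, fun v => ?_⟩
  · simp only [sat_subst, PAModel.val_emb, hφ M]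
  · simp only [sat_subst, hσ, h]

end Del

/-- The relation is the projection of a relation that is defined by an absolute formula. -/
def Sig (R : (ℕ → ℕ) → Prop) : Prop :=
  ∃ S : ℕ → (ℕ → ℕ) → Prop, (Del fun v => S (v 0) fun i => v (i + 1)) ∧ ∀ v, R v ↔ ∃ w, S w v

theorem exists_bound {P : ℕ → ℕ → Prop} {n : ℕ} (h : ∀ a < n, ∃ w, P a w) :
    ∃ b, ∀ a < n, ∃ w < b, P a w := by
  choose! w hw using h
  exact ⟨(Finset.range n).sup w + 1, fun a ha =>
    ⟨w a, Nat.lt_succ_of_le (Finset.le_sup (Finset.mem_range.2 ha)), hw a ha⟩⟩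

namespace Sig

variable {R S : (ℕ → ℕ) → Prop} {Q : ℕ → (ℕ → ℕ) → Prop} {f g : (ℕ → ℕ) → ℕ}

theorem of_iff (h : Sig R) (e : ∀ v, S v ↔ R v) : Sig S := by
  rwa [show S = R from funext fun v => propext (e v)]

theorem comp (h : Sig R) {s : ℕ → (ℕ → ℕ) → ℕ} (hs : ∀ i, IsTerm (s i)) :
    Sig fun v => R fun i => s i v := by
  obtain ⟨S, hS, h⟩ := h
  exact ⟨fun w v => S w fun i => s i v,
    hS.comp (IsTerm.cons (.var 0) fun i => (hs i).lift), fun v => h _⟩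

end Sig

theorem Del.sig {R : (ℕ → ℕ) → Prop} (h : Del R) : Sig R :=
  ⟨fun _ v => R v, h.comp fun i => .var (i + 1), fun _ => (exists_const ℕ).symm⟩

namespace Sig

variable {R S : (ℕ → ℕ) → Prop} {Q : ℕ → (ℕ → ℕ) → Prop} {f g : (ℕ → ℕ) → ℕ}

theorem and (hR : Sig R) (hS : Sig S) : Sig fun v => R v ∧ S v := by
  obtain ⟨A, hA, hR⟩ := hR
  obtain ⟨B, hB, hS⟩ := hS
  -- A single unbounded witness is allowed, so `w` is taken as a common bound for the two witnesses.
  refine ⟨fun w v => (∃ a < w, A a v) ∧ ∃ b < w, B b v, ?_, fun v => ?_⟩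
  · exact .and
      (.bex (Q := fun a v => A a fun i => v (i + 1)) (.var 0)
        (hA.comp (IsTerm.cons (.var 0) fun i => .var (i + 2))))
      (.bex (Q := fun a v => B a fun i => v (i + 1)) (.var 0)
        (hB.comp (IsTerm.cons (.var 0) fun i => .var (i + 2))))
  · refine (and_congr (hR v) (hS v)).trans ?_
    constructor
    · rintro ⟨⟨a, ha⟩, b, hb⟩
      exact ⟨a + b + 1, ⟨a, by omega, ha⟩, b, by omega, hb⟩
    · rintro ⟨w, ⟨a, -, ha⟩, b, -, hb⟩
      exact ⟨⟨a, ha⟩, b, hb⟩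

theorem ex (h : Sig fun v => Q (v 0) fun i => v (i + 1)) : Sig fun v => ∃ a, Q a v := by
  obtain ⟨S, hS, h⟩ := h
  refine ⟨fun w v => ∃ a < w, ∃ b < w, S b (cons a v), ?_, fun v => ?_⟩
  · refine .bex (Q := fun a v => ∃ b < v 0, S b (cons a fun i => v (i + 1))) (.var 0)
      (.bex (Q := fun b v => S b (cons (v 0) fun i => v (i + 2))) (.var 1) ?_)
    exact hS.comp (IsTerm.cons (.var 0) (IsTerm.cons (.var 1) fun i => .var (i + 3)))
  · have h' : ∀ a, Q a v ↔ ∃ w, S w (cons a v) := fun a => h (cons a v)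
    simp only [h']
    constructor
    · rintro ⟨a, b, hb⟩
      exact ⟨a + b + 1, a, by omega, b, by omega, hb⟩
    · rintro ⟨w, a, -, b, -, hb⟩
      exact ⟨a, b, hb⟩

/-- Finitely many witnesses have a common bound, which becomes the single outer witness. This
collection step takes place in `ℕ` only. -/
theorem ball (hf : IsTerm f) (h : Sig fun v => Q (v 0) fun i => v (i + 1)) :
    Sig fun v => ∀ a < f v, Q a v := by
  obtain ⟨S, hS, h⟩ := h
  refine ⟨fun w v => ∀ a < f v, ∃ b < w, S b (cons a v), ?_, fun v => ?_⟩
  · refine .ball (Q := fun a v => ∃ b < v 0, S b (cons a fun i => v (i + 1))) hf.lift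
      (.bex (Q := fun b v => S b (cons (v 0) fun i => v (i + 2))) (.var 1) ?_)
    exact hS.comp (IsTerm.cons (.var 0) (IsTerm.cons (.var 1) fun i => .var (i + 3)))
  · have h' : ∀ a, Q a v ↔ ∃ w, S w (cons a v) := fun a => h (cons a v)
    simp only [h']
    constructor
    · exact exists_bound
    · rintro ⟨w, hw⟩ a ha
      obtain ⟨b, -, hb⟩ := hw a ha
      exact ⟨b, hb⟩

theorem comp₂ {P : ℕ → ℕ → Prop} (h : Sig fun v => P (v 0) (v 1)) (hf : IsTerm f)
    (hg : IsTerm g) : Sig fun v => P (f v) (g v) :=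
  h.comp (IsTerm.cons hf (IsTerm.cons hg .var))

end Sig

/-- A relation that is functional in its first argument is represented in all models of Peano
arithmetic at once. -/
theorem Sig.exists_representation {R : (ℕ → ℕ) → Prop} (hR : Sig R)
    (hfun : ∀ v a b, R (cons a v) → R (cons b v) → a = b) :
    ∃ F : Formula, ∀ v m, R (cons m v) → ∀ (M : Type) [ArithStructure M] [PAModel M] (y : M),
      F.Sat (cons y fun i => emb (v i)) ↔ y = emb m := by
  obtain ⟨S, hS, hRS⟩ := hR
  obtain ⟨θ, hθ, h⟩ : Del fun v => ∃ w < v 0, S w fun i => v (i + 1) :=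
    .bex (Q := fun w v => S w fun i => v (i + 1)) (.var 0)
      (hS.comp (IsTerm.cons (.var 0) fun i => .var (i + 2)))
  -- `θ(u, a, v)` says that some witness below `u` shows `R(a, v)`. The formula says: there is `u >
  -- y` with `θ(u, y, v)` such that `θ(u', a, v)` fails for all `a < u' < u`. Thus `u` is the least
  -- number exceeding both a value and a witness for it.
  refine ⟨.ex (.and (.lt (.var 1) (.var 0)) (.and θ (.all (.imp (.lt (.var 0) (.var 1))
    (.all (.imp (.lt (.var 0) (.var 1))
      (.neg (θ.subst (cons (.var 1) (cons (.var 0) fun i => .var (i + 4))))))))))), ?_⟩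
  intro v m hm M _ _ y
  have hθM : ∀ u a : ℕ, θ.Sat (cons (emb u : M) (cons (emb a) fun i => emb (v i))) ↔
      ∃ w < u, S w (cons a v) := fun u a => by
    rw [← comp_cons emb, ← comp_cons emb, hθ M, h]
    rfl
  have hθm : ∀ u a : ℕ, θ.Sat (cons (emb u : M) (cons (emb a) fun i => emb (v i))) → a = m :=
    fun u a hu => by
      obtain ⟨w, -, hw⟩ := (hθM u a).1 hu
      exact hfun v a m ((hRS _).2 ⟨w, hw⟩) hm
  have hex : ∃ u, m < u ∧ ∃ w < u, S w (cons m v) := by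
    obtain ⟨w, hw⟩ := (hRS _).1 hm
    exact ⟨m + w + 1, by omega, w, by omega, hw⟩
  classical
  obtain ⟨hu₁, hu₂⟩ := Nat.find_spec hex
  have hmin := fun k => Nat.find_min hex (m := k)
  generalize Nat.find hex = u₀ at hu₁ hu₂ hmin
  simp only [sat_ex, sat_and, sat_lt, sat_all, sat_imp, sat_neg, sat_subst, Term.val, cons_zero,
    comp_cons (Term.val _), cons_succ]
  constructor
  · rintro ⟨u, hyu, hu, hu'⟩
    have hle : ∀ k : ℕ, u = emb k → y = emb m := by
      rintro k rfl
      obtain ⟨i, -, rfl⟩ := PAModel.lt_emb_iff.1 hyu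
      rw [hθm k i hu]
    -- If `u` is at most the true minimum `u₀`, it is standard, so `y < u` is standard too and
    -- absoluteness gives `y = m`. A larger `u`, possibly nonstandard, violates minimality at `u₀`
    -- and `m`.
    rcases PAModel.lt_trichotomy u (emb u₀) with h₁ | h₁ | h₁
    · obtain ⟨k, -, hk⟩ := PAModel.lt_emb_iff.1 h₁
      exact hle k hk
    · exact hle _ h₁
    · exact (hu' _ h₁ (emb m) (PAModel.lt_emb_iff.2 ⟨m, hu₁, rfl⟩) ((hθM _ _).2 hu₂)).elim
  · rintro rfl
    refine ⟨emb u₀, PAModel.lt_emb_iff.2 ⟨m, hu₁, rfl⟩, (hθM _ _).2 hu₂, fun u hu a ha hua => ?_⟩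
    obtain ⟨k, hk, rfl⟩ := PAModel.lt_emb_iff.1 hu
    obtain ⟨i, hi, rfl⟩ := PAModel.lt_emb_iff.1 ha
    obtain rfl := hθm _ _ hua
    exact hmin k hk ⟨hi, (hθM _ _).1 hua⟩

/-! ### Graphs of partial recursive functions -/

namespace Sig

variable {f g h : (ℕ → ℕ) → ℕ}

theorem pair (hf : IsTerm f) (hg : IsTerm g) (hh : IsTerm h) :
    Sig fun v => f v = Nat.pair (g v) (h v) := by
  refine Del.sig ((((Del.lt hg hh).and (.eq hf ((hh.mul hh).add hg))).or
    ((Del.lt hg hh).not.and (.eq hf (((hg.mul hg).add hg).add hh)))).of_iff fun v => ?_)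
  rw [Nat.pair]
  split_ifs with hlt <;> simp [hlt]

theorem beta (hf : IsTerm f) (hg : IsTerm g) (hh : IsTerm h) :
    Sig fun v => f v = Nat.beta (g v) (h v) := by
  -- The remainder that defines the beta function is characterized by a quotient `q` and the bound
  -- by the modulus.
  have key : Sig fun v => ∃ a b q, g v = Nat.pair a b ∧ f v < (h v + 1) * b + 1 ∧
      a = q * ((h v + 1) * b + 1) + f v := by
    refine .ex (.ex (.ex (.and (.pair hg.lift.lift.lift (.var 2) (.var 1)) ?_)))
    have hm : IsTerm fun v => (h (fun i => v (i + 3)) + 1) * v 1 + 1 :=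
      ((hh.lift.lift.lift.add (.const 1)).mul (.var 1)).add (.const 1)
    exact Del.sig (.and (.lt hf.lift.lift.lift hm)
      (.eq (.var 2) (((IsTerm.var 0).mul hm).add hf.lift.lift.lift)))
  refine key.of_iff fun v => ?_
  rw [Nat.beta]
  constructor
  · intro e
    refine ⟨(g v).unpair.1, (g v).unpair.2, (g v).unpair.1 / ((h v + 1) * (g v).unpair.2 + 1),
      (Nat.pair_unpair _).symm, ?_, ?_⟩
    · rw [e]
      exact Nat.mod_lt _ (Nat.succ_pos _)
    · rw [e, Nat.div_add_mod']
  · rintro ⟨a, b, q, e, hlt, rfl⟩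
    rw [e, Nat.unpair_pair, mul_comm q, Nat.mul_add_mod, Nat.mod_eq_of_lt hlt]

end Sig

/-- Gödel's beta lemma: finite sequences are coded by single numbers, so that computation histories
can be quantified over. -/
theorem exists_beta_eq (s : ℕ → ℕ) (n : ℕ) : ∃ c, ∀ i ≤ n, Nat.beta c i = s i := by
  refine ⟨Nat.unbeta ((List.range (n + 1)).map s), fun i hi => ?_⟩
  have := Nat.beta_unbeta_coe ((List.range (n + 1)).map s) ⟨i, by simp; omega⟩
  simpa using this

theorem mem_rec_iff_exists_seq (p : Part ℕ) (g : ℕ → ℕ → Part ℕ) (n m : ℕ) :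
    m ∈ (Nat.rec p (fun y IH => IH.bind (g y)) n : Part ℕ) ↔
      ∃ s : ℕ → ℕ, s 0 ∈ p ∧ (∀ i < n, s (i + 1) ∈ g i (s i)) ∧ m = s n := by
  induction n generalizing m with
  | zero =>
    constructor
    · exact fun h => ⟨fun _ => m, h, by simp, rfl⟩
    · rintro ⟨s, h, -, rfl⟩
      exact h
  | succ n ih =>
    rw [Part.mem_bind_iff]
    constructor
    · rintro ⟨k, hk, hm⟩
      obtain ⟨s, h₀, hs, rfl⟩ := (ih k).1 hk
      refine ⟨fun i => if i ≤ n then s i else m, by simpa, fun i hi => ?_, by simp⟩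
      have hin : i ≤ n := by omega
      rcases hin.lt_or_eq with h | rfl
      · simpa [hin, Nat.succ_le_of_lt h] using hs i h
      · simpa using hm
    · rintro ⟨s, h₀, hs, rfl⟩
      exact ⟨s n, (ih _).2 ⟨s, h₀, fun i hi => hs i (by omega), rfl⟩, hs n n.lt_succ_self⟩

theorem mem_rec_iff_exists_beta (p : Part ℕ) (g : ℕ → ℕ → Part ℕ) (n m : ℕ) :
    m ∈ (Nat.rec p (fun y IH => IH.bind (g y)) n : Part ℕ) ↔
      ∃ c, Nat.beta c 0 ∈ p ∧ (∀ i < n, Nat.beta c (i + 1) ∈ g i (Nat.beta c i)) ∧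
        m = Nat.beta c n := by
  rw [mem_rec_iff_exists_seq]
  constructor
  · rintro ⟨s, h₀, hs, rfl⟩
    obtain ⟨c, hc⟩ := exists_beta_eq s n
    refine ⟨c, by rwa [hc 0 (by omega)], fun i hi => ?_, (hc n le_rfl).symm⟩
    rw [hc _ hi, hc i hi.le]
    exact hs i hi
  · rintro ⟨c, h⟩
    exact ⟨Nat.beta c, h⟩

/-- Composition and pairing only add existential quantifiers over intermediate values. Primitive
recursion asserts a computation history coded by the beta function. Minimization requires that all
smaller arguments have a defined, nonzero value, which is a bounded quantifier. -/
theorem sig_of_partrec {f : ℕ →. ℕ} (hf : Nat.Partrec f) : Sig fun v => v 0 ∈ f (v 1) := by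
  induction hf with
  | zero =>
    exact (Del.eq (.var 0) (.const 0)).sig.of_iff fun v => by
      simp [pure, PFun.pure, Part.mem_some_iff]
  | succ =>
    exact (Del.eq (.var 0) ((IsTerm.var 1).add (.const 1))).sig.of_iff fun v => by simp
  | left =>
    refine (Sig.ex (Q := fun b v => v 1 = Nat.pair (v 0) b)
      (.pair (.var 2) (.var 1) (.var 0))).of_iff fun v => ?_
    simp only [PFun.coe_val, Part.mem_some_iff]
    constructor
    · intro h
      exact ⟨(v 1).unpair.2, by rw [h, Nat.pair_unpair]⟩
    · rintro ⟨b, hb⟩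
      rw [hb, Nat.unpair_pair]
  | right =>
    refine (Sig.ex (Q := fun b v => v 1 = Nat.pair b (v 0))
      (.pair (.var 2) (.var 0) (.var 1))).of_iff fun v => ?_
    simp only [PFun.coe_val, Part.mem_some_iff]
    constructor
    · intro h
      exact ⟨(v 1).unpair.1, by rw [h, Nat.pair_unpair]⟩
    · rintro ⟨b, hb⟩
      rw [hb, Nat.unpair_pair]
  | @pair f g _ _ ihf ihg =>
    refine (Sig.ex (Q := fun a v => ∃ b, a ∈ f (v 1) ∧ b ∈ g (v 1) ∧ v 0 = Nat.pair a b)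
      (.ex ((ihf.comp₂ (P := fun a b => a ∈ f b) (.var 1) (.var 3)).and
        ((ihg.comp₂ (P := fun a b => a ∈ g b) (.var 0) (.var 3)).and
          (.pair (.var 2) (.var 1) (.var 0)))))).of_iff fun v => ?_
    simp [Seq.seq, eq_comm]
  | @comp f g _ _ ihf ihg =>
    refine (Sig.ex (Q := fun a v => a ∈ g (v 1) ∧ v 0 ∈ f a)
      ((ihg.comp₂ (P := fun a b => a ∈ g b) (.var 0) (.var 2)).and
        (ihf.comp₂ (P := fun a b => a ∈ f b) (.var 1) (.var 0)))).of_iff fun v => ?_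
    exact Part.mem_bind_iff
  | @prec f g _ _ ihf ihg =>
    -- Pairing and beta are available only as relations, so each of their intermediate values is
    -- named by an existential quantifier.
    have key : Sig fun v => ∃ a n c, v 1 = Nat.pair a n ∧ v 0 = Nat.beta c n ∧
        (∃ z, z = Nat.beta c 0 ∧ z ∈ f a) ∧
        ∀ i < n, ∃ y z k l, y = Nat.beta c i ∧ z = Nat.beta c (i + 1) ∧ k = Nat.pair i y ∧
          l = Nat.pair a k ∧ z ∈ g l := by
      refine .ex (.ex (.ex ?_))
      refine .and (.pair (.var 4) (.var 2) (.var 1)) (.and (.beta (.var 3) (.var 0) (.var 1)) ?_)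
      refine .and (.ex (.and (.beta (.var 0) (.var 1) (.const 0))
        (ihf.comp₂ (P := fun a b => a ∈ f b) (.var 0) (.var 3)))) ?_
      refine Sig.ball (Q := fun i v => ∃ y z k l, y = Nat.beta (v 0) i ∧
        z = Nat.beta (v 0) (i + 1) ∧ k = Nat.pair i y ∧ l = Nat.pair (v 2) k ∧ z ∈ g l)
        (.var 1) (.ex (.ex (.ex (.ex ?_))))
      exact .and (.beta (.var 3) (.var 5) (.var 4))
        (.and (.beta (.var 2) (.var 5) ((IsTerm.var 4).add (.const 1)))
        (.and (.pair (.var 1) (.var 4) (.var 3)) (.and (.pair (.var 0) (.var 7) (.var 1))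
        (ihg.comp₂ (P := fun a b => a ∈ g b) (.var 2) (.var 0)))))
    refine key.of_iff fun v => ?_
    have h := mem_rec_iff_exists_beta (f (v 1).unpair.1)
      (fun y i => g (Nat.pair (v 1).unpair.1 (Nat.pair y i))) (v 1).unpair.2 (v 0)
    refine h.trans ?_
    constructor
    · rintro ⟨c, h₀, hs, hm⟩
      exact ⟨_, _, c, (Nat.pair_unpair _).symm, hm, ⟨_, rfl, h₀⟩,
        fun i hi => ⟨_, _, _, _, rfl, rfl, rfl, rfl, hs i hi⟩⟩
    · rintro ⟨a, n, c, e, hm, ⟨_, rfl, h₀⟩, hs⟩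
      rw [e, Nat.unpair_pair]
      refine ⟨c, h₀, fun i hi => ?_, hm⟩
      obtain ⟨_, _, _, _, rfl, rfl, rfl, rfl, h'⟩ := hs i hi
      exact h'
  | @rfind f _ ihf =>
    have key : Sig fun v => (∃ k z, k = Nat.pair (v 1) (v 0) ∧ z = 0 ∧ z ∈ f k) ∧
        ∀ i < v 0, ∃ k z, k = Nat.pair (v 1) i ∧ z ≠ 0 ∧ z ∈ f k := by
      refine .and (.ex (.ex (.and (.pair (.var 1) (.var 3) (.var 2)) (.and
        (Del.eq (.var 0) (.const 0)).sig
        (ihf.comp₂ (P := fun a b => a ∈ f b) (.var 0) (.var 1)))))) ?_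
      exact Sig.ball (Q := fun i v => ∃ k z, k = Nat.pair (v 1) i ∧ z ≠ 0 ∧ z ∈ f k) (.var 0)
        (.ex (.ex (.and (.pair (.var 1) (.var 4) (.var 2)) (.and
        (Del.eq (.var 0) (.const 0)).not.sig
        (ihf.comp₂ (P := fun a b => a ∈ f b) (.var 0) (.var 1))))))
    refine key.of_iff fun v => ?_
    refine Nat.mem_rfind.trans (and_congr (by simp) ?_)
    refine ⟨fun h i hi => ?_, fun h i hi => ?_⟩
    · obtain ⟨z, hz, h0⟩ := (Part.mem_map_iff _).1 (h hi)
      exact ⟨_, z, rfl, by simpa using h0, hz⟩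
    · obtain ⟨_, z, rfl, h0, hz⟩ := h i hi
      exact (Part.mem_map_iff _).2 ⟨z, hz, by simpa using h0⟩

/-- The formula obtained so far may have further free variables. Replacing those by zero leaves only
the value and `k` arguments, and agrees with assignments that vanish from `k` on. -/
theorem Sig.exists_closed_representation {R : (ℕ → ℕ) → Prop} (hR : Sig R)
    (hfun : ∀ v a b, R (cons a v) → R (cons b v) → a = b) (k : ℕ) :
    ∃ F : Formula, F.ClosedAt (k + 1) ∧ ∀ v m, (∀ i, k ≤ i → v i = 0) → R (cons m v) →
      ∀ (M : Type) [ArithStructure M] [PAModel M] (y : M) (w : ℕ → M),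
        (∀ i < k, w i = emb (v i)) → (F.Sat (cons y w) ↔ y = emb m) := by
  obtain ⟨F, hF⟩ := hR.exists_representation hfun
  refine ⟨F.subst fun i => if i < k + 1 then .var i else .zero, ?_,
    fun v m hv hm M _ _ y w hw => ?_⟩
  · obtain ⟨n, hn⟩ := F.exists_closedAt
    refine hn.subst fun i _ => ?_
    split_ifs with h
    exacts [h, trivial]
  · rw [sat_subst, ← hF v m hm M]
    congr! 1
    refine cons_ext (by simp [Term.val]) fun i => ?_
    by_cases hi : i < k
    · simp [hi, hw i hi, Term.val]
    · simp [hi, hv i (by omega), Term.val, emb]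

/-- A partial computable function is represented, in all models of Peano arithmetic at once. -/
theorem exists_representation_of_partrec {f : ℕ →. ℕ} (hf : Nat.Partrec f) :
    ∃ F : Formula, F.ClosedAt 2 ∧ ∀ n m, m ∈ f n → ∀ (M : Type) [ArithStructure M] [PAModel M]
      (y : M) (w : ℕ → M), F.Sat (cons y (cons (emb n) w)) ↔ y = emb m := by
  obtain ⟨F, hF, h⟩ := (sig_of_partrec hf).exists_closed_representation
    (fun v a b ha hb => Part.mem_unique ha hb) 1
  exact ⟨F, hF, fun n m hm M _ _ y w => h (cons n fun _ => 0) m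
    (fun i hi => by cases i; exacts [absurd hi (by omega), rfl]) hm M y _
    (fun i hi => by simp [Nat.lt_one_iff.1 hi])⟩

/-- A computable function of two variables is represented, in all models of Peano arithmetic at
once. -/
theorem exists_representation_of_computable₂ {f : ℕ → ℕ → ℕ} (hf : Computable₂ f) :
    ∃ F : Formula, F.ClosedAt 3 ∧ ∀ a b, ∀ (M : Type) [ArithStructure M] [PAModel M]
      (y : M) (w : ℕ → M), F.Sat (cons y (cons (emb a) (cons (emb b) w))) ↔ y = emb (f a b) := by
  have hc : Computable fun n : ℕ => f n.unpair.1 n.unpair.2 :=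
    hf.comp (Computable.fst.comp Computable.unpair) (Computable.snd.comp Computable.unpair)
  have hs : Sig fun v => v 0 = f (v 1) (v 2) := by
    refine (Sig.ex (Q := fun n v => n = Nat.pair (v 1) (v 2) ∧
      v 0 ∈ (Part.some (f n.unpair.1 n.unpair.2))) (.and (.pair (.var 0) (.var 2) (.var 3))
      ((sig_of_partrec (Partrec.nat_iff.1 hc)).comp₂
        (P := fun a b => a ∈ Part.some (f b.unpair.1 b.unpair.2)) (.var 1) (.var 0)))).of_iff
      fun v => ?_
    simp
  obtain ⟨F, hF, h⟩ := hs.exists_closed_representation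
    (fun v a b ha hb => ha.trans hb.symm) 2
  exact ⟨F, hF, fun a b M _ _ y w => h (cons a (cons b fun _ => 0)) _
    (fun i hi => by match i with | 0 => omega | 1 => omega | i + 2 => rfl) rfl M y _
    (fun i hi => by match i with | 0 => rfl | 1 => rfl)⟩

/-! ### Computability of concatenation -/

theorem primrec₂_pow : Primrec₂ ((· ^ ·) : ℕ → ℕ → ℕ) := Primrec₂.unpaired'.1 Nat.Primrec.pow

theorem primrec_log {b : ℕ} (hb : 1 < b) : Primrec (Nat.log b) := by
  have h : PrimrecRel fun n k : ℕ => b ^ k ≤ n :=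
    Primrec.nat_le.comp (primrec₂_pow.comp (Primrec.const b) Primrec.snd) Primrec.fst
  refine (Primrec.nat_findGreatest Primrec.id h).of_eq fun n => ?_
  rw [Nat.findGreatest_eq_iff]
  refine ⟨Nat.log_le_self _ _, fun h0 => Nat.pow_log_le_self b ?_, fun k hk _ => ?_⟩
  · rintro rfl
    simp at h0
  · exact not_le.2 (Nat.lt_pow_of_log_lt hb hk)

theorem primrec₂_cat : Primrec₂ cat :=
  Primrec.nat_add.comp (Primrec.nat_mul.comp Primrec.fst (primrec₂_pow.comp (Primrec.const 10)
    (Primrec.succ.comp ((primrec_log (by norm_num)).comp Primrec.snd)))) Primrec.snd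

/-! ### Undecidable sentences -/

/-- The structure is a model of the set of sentences. -/
def IsModel (M : Type) [ArithStructure M] (T : Set Formula) : Prop :=
  ∀ B ∈ T, ∀ v : ℕ → M, B.Sat v

theorem IsModel.paModel {M : Type} [ArithStructure M] {T : Set Formula} (h : IsModel M T)
    (hPA : IsExtension T PA) : PAModel M :=
  .of_sat fun A hA => h A (hPA (paAxioms_subset_PA hA))

theorem num_string (n : ℕ) : (num n).string = List.replicate n .succ ++ [.zero] := by
  induction n with
  | zero => rfl
  | succ n ih => exact congrArg (List.cons _) ih

/-- The numeral occurs just once in the string of `φ.applyNum n`, between strings that do not depend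
on `n`. Codes of instances are therefore primitive recursive in `n` without arithmetizing
substitution. -/
theorem primrec_stringNumber_num (l m : List Letter) :
    Primrec fun n => stringNumber (l ++ (num n).string ++ m) := by
  have h : Primrec fun n => stringNumber (l ++ List.replicate n .succ) := by
    refine (Primrec.nat_rec₁ (f := fun _ k => k * 10 + 3) (stringNumber l)
      (Primrec.nat_add.comp (Primrec.nat_mul.comp Primrec.snd (Primrec.const 10))
        (Primrec.const 3))).of_eq fun n => ?_
    induction n with
    | zero => simp
    | succ n ih =>
      rw [List.replicate_succ', ← List.append_assoc, stringNumber_append, ← ih]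
      rfl
  refine (Primrec.nat_add.comp (Primrec.nat_mul.comp h (Primrec.const (10 ^ (m.length + 1))))
    (Primrec.const (stringNumber (.zero :: m)))).of_eq fun n => ?_
  have e : l ++ (num n).string ++ m = (l ++ List.replicate n .succ) ++ .zero :: m := by
    simp [num_string]
  rw [e, stringNumber_append _ (.zero :: m), List.length_cons]

/-- `φ(n)`, expressed as `∀ x, x = n → φ(x)`. -/
def Formula.applyNum (φ : Formula) (n : ℕ) : Formula := .all (.imp (.eq (.var 0) (num n)) φ)

theorem Formula.ClosedAt.applyNum {φ : Formula} (h : φ.ClosedAt 1) (n : ℕ) :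
    (φ.applyNum n).IsSentence :=
  ⟨⟨Nat.zero_lt_one, num_closedAt n 1⟩, h⟩

theorem sat_applyNum {M : Type} [ArithStructure M] (v : ℕ → M) (φ : Formula) (n : ℕ) :
    (φ.applyNum n).Sat v ↔ φ.Sat (cons (emb n) v) := by
  simp [Formula.applyNum, Term.val]

theorem primrec_code_applyNum (φ : Formula) : Primrec fun n => (φ.applyNum n).code :=
  (primrec_stringNumber_num [.all, .imp, .eq, .x] φ.string).of_eq fun n => by
    simp [Formula.applyNum, Formula.code, Formula.string, Term.string]

theorem primrec_code_neg_applyNum (φ : Formula) : Primrec fun n => (φ.applyNum n).neg.code :=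
  (primrec_stringNumber_num [.neg, .all, .imp, .eq, .x] φ.string).of_eq fun n => by
    simp [Formula.applyNum, Formula.code, Formula.string, Term.string]

theorem IsProofVerifier.exists_iff {T : Set Formula} {pc : ℕ → ℕ → Bool}
    (h : IsProofVerifier T pc) {A : Formula} (hA : A.IsSentence) :
    (∃ p, pc p A.code = true) ↔ A ∈ T := by
  rw [h]
  constructor
  · rintro ⟨B, -, hB, hBT⟩
    rwa [← Formula.code_injective hB]
  · exact fun hAT => ⟨A, hA, rfl, hAT⟩

/-- Unbounded search for `p` halts exactly when some `p` is accepted. -/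
theorem rePred_exists {pc : ℕ → ℕ → Bool} (h : Computable₂ pc) {c : ℕ → ℕ} (hc : Primrec c) :
    REPred fun n => ∃ p, pc p (c n) = true := by
  have h' : Computable₂ fun n p => pc p (c n) :=
    h.comp Computable.snd (hc.to_comp.comp Computable.fst)
  refine (Partrec.dom_re (Partrec.rfind h'.partrec₂)).of_eq fun n => ?_
  exact ⟨fun ⟨p, hp, _⟩ => ⟨p, (Part.mem_some_iff.1 hp).symm⟩,
    fun ⟨p, hp⟩ => Nat.rfind_dom.2 ⟨p, Part.mem_some_iff.2 hp.symm, fun _ => trivial⟩⟩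

section

variable {T : Set Formula}

/-- The first incompleteness theorem. -/
theorem exists_undecidable (hT : IsTheory T) (hcons : Consistent T)
    (hce : IsComputablyEnumerable T) (hPA : IsExtension T PA) :
    ∃ A : Formula, A.IsSentence ∧ A ∉ T ∧ A.neg ∉ T := by
  by_contra! hcomp
  obtain ⟨pc, hpc, hver⟩ := hce
  have hU : Partrec fun e : ℕ => (Denumerable.ofNat Nat.Partrec.Code e).eval e :=
    Nat.Partrec.Code.eval_part.comp (Computable.ofNat _) Computable.id
  obtain ⟨F, hF, hrep⟩ := exists_representation_of_partrec (Partrec.nat_iff.1 hU)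
  -- `F` takes the value before the input, so `G(e)` says that program `e` outputs `0` on input `e`.
  let G := F.app [.zero, .var 0]
  have hG : ∀ e, (G.applyNum e).IsSentence := fun e =>
    Formula.ClosedAt.applyNum (hF.app le_rfl (by simp [Term.ClosedAt])) e
  have hsat : ∀ {e m : ℕ}, m ∈ (Denumerable.ofNat Nat.Partrec.Code e).eval e →
      ∀ (M : Type) [ArithStructure M], IsModel M T → ∀ v : ℕ → M, (G.applyNum e).Sat v ↔ 0 = m := by
    intro e m hm M _ hM v
    have := hM.paModel hPA
    rw [sat_applyNum, sat_app]
    exact (hrep e m hm M (emb 0) _).trans PAModel.emb_inj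
  have hneg : ∀ e, (G.applyNum e).neg ∈ T ↔ G.applyNum e ∉ T := fun e =>
    ⟨fun h h' => hcons ⟨_, hG e, h', h⟩, hcomp _ (hG e)⟩
  -- By completeness of `T`, a sentence is unprovable exactly when its negation is provable, so both
  -- the predicate and its complement are enumerable.
  have hdec : ComputablePred fun e => G.applyNum e ∈ T := by
    refine ComputablePred.computable_iff_re_compl_re'.2 ⟨?_, ?_⟩
    · exact (rePred_exists hpc (primrec_code_applyNum G)).of_eq fun e => hver.exists_iff (hG e)
    · exact (rePred_exists hpc (primrec_code_neg_applyNum G)).of_eq fun e =>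
        (hver.exists_iff (A := (G.applyNum e).neg) (hG e)).trans (hneg e)
  obtain ⟨d, hd, hdT⟩ := ComputablePred.computable_iff.1 hdec
  have hdT : ∀ e, G.applyNum e ∈ T ↔ d e = true := fun e => iff_of_eq (congrFun hdT e)
  -- The diagonal program outputs `1` if `T` proves that program `e` outputs `0` on input `e`, and
  -- `0` otherwise.
  have hf : Computable fun e => bif d e then 1 else 0 :=
    Computable.cond hd (Computable.const 1) (Computable.const 0)
  obtain ⟨c, hc⟩ := Nat.Partrec.Code.exists_code.1 (Partrec.nat_iff.1 hf)
  have hval : (bif d (Encodable.encode c) then 1 else 0) ∈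
      (Denumerable.ofNat Nat.Partrec.Code (Encodable.encode c)).eval (Encodable.encode c) := by
    rw [Denumerable.ofNat_encode, hc]
    exact Part.mem_some _
  have hiff := hsat hval
  cases hde : d (Encodable.encode c) with
  | true =>
    rw [hde] at hiff
    have h₁ : (G.applyNum (Encodable.encode c)).neg ∈ T := hT.mem_of_forall_sat (hG _) fun M _ hM =>
      ⟨fun _ => ArithStructure.zero, fun h => by simpa using (hiff M hM _).1 h⟩
    exact (hneg _).1 h₁ ((hdT _).2 hde)
  | false =>
    rw [hde] at hiff
    have h₁ : G.applyNum (Encodable.encode c) ∈ T := hT.mem_of_forall_sat (hG _) fun M _ hM =>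
      ⟨fun _ => ArithStructure.zero, (hiff M hM _).2 rfl⟩
    simpa [hde] using (hdT _).1 h₁

/-- One of an undecidable sentence and its negation is false. Falsity is needed for the correctness
of the predicate that has `ρ` as a disjunct. -/
theorem exists_false_undecidable (hT : IsTheory T) (hcons : Consistent T)
    (hce : IsComputablyEnumerable T) (hPA : IsExtension T PA) :
    ∃ A : Formula, A.IsSentence ∧ ¬ A.IsTrue ∧ A ∉ T ∧ A.neg ∉ T := by
  obtain ⟨A, hA, h₁, h₂⟩ := exists_undecidable hT hcons hce hPA
  by_cases h : A.IsTrue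
  · refine ⟨A.neg, hA, not_not.2 h, h₂, fun h₃ => h₁ (hT.mem_of_forall_sat hA fun M _ hM => ?_)⟩
    exact ⟨fun _ => ArithStructure.zero, not_not.1 (hM _ h₃ _)⟩
  · exact ⟨A, hA, h, h₁, h₂⟩

/-- The theorems can be enumerated by a total computable function. -/
theorem exists_enumeration (hce : IsComputablyEnumerable T) (hPA : IsExtension T PA) :
    ∃ f : ℕ → ℕ, Computable f ∧ (∀ p, ∃ A ∈ T, A.code = f p) ∧ ∀ A ∈ T, A.IsSentence →
      ∃ p, f p = A.code := by
  obtain ⟨pc, hpc, hver⟩ := hce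
  -- Some theorem is needed as the value of the enumeration at pairs that the verifier rejects; the
  -- axiom `x + 0 = x` serves.
  have h₀ : Formula.all (.eq (.add (.var 0) .zero) (.var 0)) ∈ T :=
    hPA (paAxioms_subset_PA (.inl .a0))
  generalize Formula.all (.eq (.add (.var 0) .zero) (.var 0)) = A₀ at h₀
  have hl : Computable fun n : ℕ => n.unpair.1 := Computable.fst.comp Computable.unpair
  have hr : Computable fun n : ℕ => n.unpair.2 := Computable.snd.comp Computable.unpair
  refine ⟨fun n => bif pc n.unpair.1 n.unpair.2 then n.unpair.2 else A₀.code,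
    Computable.cond (hpc.comp hl hr) hr (Computable.const _), fun p => ?_, fun A hA hs => ?_⟩
  · cases h : pc p.unpair.1 p.unpair.2 with
    | true =>
      obtain ⟨A, -, hc, hA⟩ := (hver _).1 ⟨_, h⟩
      exact ⟨A, hA, by simpa [h] using hc⟩
    | false => exact ⟨A₀, h₀, by simp [h]⟩
  · obtain ⟨p, hp⟩ := (hver.exists_iff hs).2 hA
    exact ⟨Nat.pair p A.code, by simp [hp]⟩

end

/-! ### Representation of concatenation -/

theorem Formula.ClosedAt.exUnique {φ : Formula} {n : ℕ} (h : φ.ClosedAt (n + 1)) :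
    φ.exUnique.ClosedAt n := by
  refine ⟨h, Formula.ClosedAt.subst h fun i hi => ?_, Nat.zero_lt_succ _,
    Nat.succ_lt_succ (Nat.zero_lt_succ _)⟩
  cases i with
  | zero => exact Nat.zero_lt_succ _
  | succ i => exact Nat.succ_lt_succ hi

theorem exists_correctlyRepresents₂ {T : Set Formula} (hT : IsTheory T) (hPA : IsExtension T PA)
    {f : ℕ → ℕ → ℕ} (hf : Computable₂ f) : ∃ r, CorrectlyRepresents₂ T r f := by
  obtain ⟨F, hF, h⟩ := exists_representation_of_computable₂ hf
  -- `F` has the value as its first variable, whereas `r` must have it last.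
  let r := F.subst (cons (.var 2) (cons (.var 0) fun _ => .var 1))
  have hr : r.ClosedAt 3 := hF.subst fun i _ => by
    match i with
    | 0 => exact Nat.lt_succ_self 2
    | 1 => exact Nat.zero_lt_succ 2
    | i + 2 => exact Nat.succ_lt_succ (Nat.zero_lt_succ 1)
  have hsat : ∀ (M : Type) [ArithStructure M] [PAModel M] (a b : ℕ) (v : ℕ → M) (t : Term),
      (r.app [num a, num b, t]).Sat v ↔ t.val v = emb (f a b) := by
    intro M _ _ a b v t
    rw [sat_app, sat_subst, comp_cons, comp_cons, ← h a b M _ fun _ => emb b]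
    refine hF.sat_congr fun i hi => ?_
    match i with
    | 0 => rfl
    | 1 => exact val_num _ _
    | 2 => exact val_num _ _
  refine ⟨r, ⟨hr, fun a b => hT.mem_of_forall_sat ⟨?_, ?_⟩ fun M _ hM => ?_⟩, fun a b c => ?_⟩
  · refine Formula.ClosedAt.exUnique (hr.app le_rfl ?_)
    simp [num_closedAt, Term.ClosedAt]
  · refine hr.app le_rfl ?_
    simp [num_closedAt]
  · have := IsModel.paModel hM hPA
    refine ⟨fun _ => ArithStructure.zero, ?_⟩
    simp only [sat_and, sat_exUnique, hsat, Term.val, cons_zero, val_num, existsUnique_eq,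
      true_and]
  · rw [Formula.IsTrue, holds_iff_sat, hsat, val_num, emb_nat, emb_nat, eq_comm]

/-! ### The provability predicate -/

section

variable {M : Type} [ArithStructure M]

/-- Satisfaction of a formula in two free variables. -/
def Formula.Sat₂ (φ : Formula) (a b : M) : Prop := φ.Sat (cons a (cons b fun _ => b))

/-- Satisfaction of a formula in three free variables. -/
def Formula.Sat₃ (φ : Formula) (a b c : M) : Prop := φ.Sat (cons a (cons b (cons c fun _ => c)))

theorem Formula.ClosedAt.sat₂ {φ : Formula} (h : φ.ClosedAt 2) (a b : M) (v : ℕ → M) :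
    φ.Sat (cons a (cons b v)) ↔ φ.Sat₂ a b :=
  h.sat_congr fun i hi => by match i with | 0 => rfl | 1 => rfl

theorem Formula.ClosedAt.sat₃ {φ : Formula} (h : φ.ClosedAt 3) (a b c : M) (v : ℕ → M) :
    φ.Sat (cons a (cons b (cons c v))) ↔ φ.Sat₃ a b c :=
  h.sat_congr fun i hi => by match i with | 0 => rfl | 1 => rfl | 2 => rfl

end

/-- For enumerations `E` of the theorems, given as relations between theorems and indices: no two
theorems with indices up to the free variable `0` are a formula and its negation, where negation
is expressed by the formula `r` for concatenation. -/
def consistentUpTo (E r : Formula) : Formula :=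
  -- Under the four quantifiers, variable `4` is the bound, `3` and `2` are the indices, and `1` and
  -- `0` are the theorems with these indices.
  .all (.all (.all (.all (.imp (.lt (.var 3) (.succ (.var 4))) (.imp
    (.lt (.var 2) (.succ (.var 4))) (.imp (E.app [.var 1, .var 3]) (.imp (E.app [.var 0, .var 2])
      (.neg (r.app [num negCode, .var 1, .var 0])))))))))

/-- Either `ρ`, or `x` has an index `p` such that the theorems up to `p` are consistent. -/
def rosserPvb (ρ E r : Formula) : Formula :=
  .or ρ (.ex (.and (E.app [.var 1, .var 0]) (consistentUpTo E r)))

theorem rosserPvb_closedAt {ρ E r : Formula} (hρ : ρ.IsSentence) (hE : E.ClosedAt 2)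
    (hr : r.ClosedAt 3) : (rosserPvb ρ E r).ClosedAt 1 := by
  have h₁ : ∀ {i j n : ℕ}, i < n → j < n → (E.app [.var i, .var j]).ClosedAt n := fun hi hj =>
    hE.app le_rfl (by simp [Term.ClosedAt, hi, hj])
  have h₂ : (r.app [num negCode, .var 1, .var 0]).ClosedAt 6 :=
    hr.app le_rfl (by simp [Term.ClosedAt, num_closedAt])
  simp only [rosserPvb, consistentUpTo, Formula.or, Formula.ex, Formula.and, Formula.lt,
    Formula.ClosedAt]
  simp [h₁, h₂, hρ.mono, Term.ClosedAt, Term.shift, Term.subst]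

section

variable {M : Type} [ArithStructure M] {ρ E r : Formula}

theorem sat_rosserPvb (hE : E.ClosedAt 2) (hr : r.ClosedAt 3) (x : M) (v : ℕ → M) :
    (rosserPvb ρ E r).Sat (cons x v) ↔ ρ.Sat (cons x v) ∨ ∃ p, E.Sat₂ x p ∧
      ∀ p₁ p₂ a b, Lt p₁ (ArithStructure.succ p) → Lt p₂ (ArithStructure.succ p) →
        E.Sat₂ a p₁ → E.Sat₂ b p₂ → ¬ r.Sat₃ (emb negCode) a b := by
  simp only [rosserPvb, consistentUpTo, sat_or, sat_ex, sat_and, sat_all, sat_imp, sat_neg, sat_lt,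
    sat_app, List.foldr, Term.val, val_num, hE.sat₂, hr.sat₃, cons_zero, cons_succ]

theorem sat_consistencyStatement {P : Formula} (hr : r.ClosedAt 3) (hP : P.ClosedAt 1)
    (v : ℕ → M) : (consistencyStatement r P).Sat v ↔ ¬ ∃ x, P.Sat (cons x v) ∧
      (∃! y, r.Sat₃ (emb negCode) x y) ∧ ∃ y, r.Sat₃ (emb negCode) x y ∧ P.Sat (cons y v) := by
  have h : ∀ (x : M) (w : ℕ → M), P.Sat (cons x w) ↔ P.Sat (cons x v) := fun x w =>
    hP.sat_congr fun i hi => by match i with | 0 => rfl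
  simp only [consistencyStatement, appFun₂, sat_ex, sat_and, sat_neg, sat_exUnique, sat_app,
    List.foldr, val_shift, Term.val, val_num, cons_zero, hr.sat₃, h _ (cons _ _)]

end

theorem exists_weakProvabilityPredicate_undecidable (T : Set Formula)
    (hT : IsTheory T) (hcons : Consistent T) (hce : IsComputablyEnumerable T) (hPA : IsExtension T PA) (r : Formula)
    (hr : CorrectlyRepresents₂ T r cat) :
    ∃ Pvb, IsWeakProvabilityPredicate T Pvb ∧ Undecidable T (consistencyStatement r Pvb) := by
  obtain ⟨ρ, hρs, hρ, hρ₁, hρ₂⟩ := exists_false_undecidable hT hcons hce hPA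
  obtain ⟨f, hf, hfT, hTf⟩ := exists_enumeration hce hPA
  obtain ⟨E, hE, hEf⟩ := exists_representation_of_partrec (Partrec.nat_iff.1 hf)
  have hEf : ∀ (M : Type) [ArithStructure M] [PAModel M] (n : ℕ) (y : M),
      E.Sat₂ y (emb n) ↔ y = emb (f n) := fun M _ _ n y => hEf n (f n) (Part.mem_some _) M y _
  obtain ⟨⟨hr₃, hrT⟩, hrN⟩ := hr
  have hrT : ∀ (M : Type) [ArithStructure M], IsModel M T → ∀ (a b : ℕ) (y : M),
      r.Sat₃ (emb a) (emb b) y ↔ y = emb (cat a b) := by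
    intro M _ hM a b y
    have := hM _ (hrT a b) fun _ => y
    simp only [sat_and, sat_exUnique, sat_app, List.foldr, val_num, hr₃.sat₃, Term.val,
      cons_zero] at this
    exact ⟨fun h => this.1.unique h this.2, fun h => h ▸ this.2⟩
  have hrN : ∀ a b c : ℕ, r.Sat₃ (emb a) (emb b) (emb c : ℕ) ↔ cat a b = c := by
    intro a b c
    rw [← hrN, Formula.IsTrue, holds_iff_sat, sat_app]
    simp only [List.foldr, val_num, hr₃.sat₃]
  have hP := rosserPvb_closedAt hρs hE hr₃
  -- The actual consistency of `T`: no two enumerated codes belong to a formula and its negation.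
  have hcat : ∀ p q, cat negCode (f p) ≠ f q := by
    intro p q h
    obtain ⟨A, hA, hAp⟩ := hfT p
    obtain ⟨B, hB, hBq⟩ := hfT q
    rw [← hAp, ← hBq, Formula.cat_negCode] at h
    exact hcons ⟨A, hT.1 A hA, hA, Formula.code_injective h ▸ hB⟩
  -- A theorem has a standard index `p`. All indices up to `p` are then standard, `E` forces the
  -- elements at them to be enumerated codes, and a violation in `M` would contradict the actual
  -- consistency of `T`.
  have hcorrect : ∀ (M : Type) [ArithStructure M] [PAModel M],
      (∀ a b c : ℕ, r.Sat₃ (emb a) (emb b) (emb c : M) → cat a b = c) → ∀ A ∈ T, ∀ v : ℕ → M,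
      (rosserPvb ρ E r).Sat (cons (emb A.code) v) := by
    intro M _ _ hrM A hA v
    obtain ⟨p, hp⟩ := hTf A hA (hT.1 A hA)
    refine (sat_rosserPvb hE hr₃ _ _).2 (.inr ⟨emb p, (hEf M p _).2 (by rw [hp]), ?_⟩)
    intro p₁ p₂ a b h₁ h₂ ha hb h
    obtain ⟨q₁, -, rfl⟩ := (PAModel.lt_emb_iff (n := p + 1)).1 h₁
    obtain ⟨q₂, -, rfl⟩ := (PAModel.lt_emb_iff (n := p + 1)).1 h₂
    rw [(hEf M _ _).1 ha, (hEf M _ _).1 hb] at h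
    exact hcat _ _ (hrM _ _ _ h)
  -- The heart of the argument: `Con` is equivalent to `¬ ρ` in every model of `T`.
  have hcon : ∀ (M : Type) [ArithStructure M], IsModel M T → ∀ v : ℕ → M,
      (consistencyStatement r (rosserPvb ρ E r)).Sat v ↔ ¬ ρ.Sat v := by
    intro M _ hM v
    have := hM.paModel hPA
    have hρM : ∀ x : M, ρ.Sat (cons x v) ↔ ρ.Sat v := fun x => hρs.sat_congr
    rw [sat_consistencyStatement hr₃ hP]
    simp only [sat_rosserPvb hE hr₃, hρM]
    by_cases h : ρ.Sat v
    · simp only [h, true_or, true_and, and_true, not_true, iff_false, not_not]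
      -- When `ρ` holds, `Pvb` holds everywhere, and any `x` refutes `Con` at which `r` has a unique
      -- value. A standard `x` such as `0` will do.
      refine ⟨emb 0, ?_, _, (hrT M hM _ _ _).2 rfl⟩
      simp [hrT M hM]
    · simp only [h, false_or, not_false_iff, iff_true]
      rintro ⟨x, ⟨p, hxp, hp⟩, -, y, hxy, q, hyq, hq⟩
      have hself : ∀ p : M, Lt p (ArithStructure.succ p) := fun p =>
        ⟨ArithStructure.zero, by rw [PAModel.add_succ, PAModel.add_zero]⟩
      have hlt : ∀ {p q : M}, Lt p q → Lt p (ArithStructure.succ q) := by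
        rintro p _ ⟨z, rfl⟩
        exact ⟨ArithStructure.succ z, PAModel.add_succ _ _⟩
      -- Both theorems have indices up to the larger of `p` and `q`, so the consistency clause
      -- attached to that index excludes that one is the negation of the other.
      rcases PAModel.lt_trichotomy p q with hpq | rfl | hpq
      · exact hq p q x y (hlt hpq) (hself q) hxp hyq hxy
      · exact hq p p x y (hself p) (hself p) hxp hyq hxy
      · exact hp p q x y (hself p) (hlt hpq) hxp hyq hxy
  refine ⟨rosserPvb ρ E r, ⟨hP, fun A hA => ⟨⟨fun h => ?_, fun h => ?_⟩, fun h => ?_⟩⟩, ?_, ?_⟩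
  · rw [Formula.IsTrue, holds_iff_sat, sat_app] at h
    simp only [List.foldr, val_num, sat_rosserPvb hE hr₃] at h
    rcases h with h | ⟨p, hp, -⟩
    · exact (hρ ((holds_iff_sat _ _).2 (hρs.sat_congr.1 h))).elim
    · rw [← emb_nat p, hEf, PAModel.emb_inj] at hp
      obtain ⟨B, hB, hBp⟩ := hfT p
      rw [← hBp] at hp
      exact Formula.code_injective hp ▸ hB
  · rw [Formula.IsTrue, holds_iff_sat, sat_app]
    simp only [List.foldr, val_num]
    exact hcorrect ℕ (fun a b c => (hrN a b c).1) A h _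
  · refine hT.mem_of_forall_sat (hP.app le_rfl (by simp [num_closedAt])) fun M _ hM => ?_
    have := IsModel.paModel hM hPA
    refine ⟨fun _ => ArithStructure.zero, ?_⟩
    rw [sat_app]
    simp only [List.foldr, val_num]
    refine hcorrect M (fun a b c h => ?_) A h _
    exact (PAModel.emb_inj.1 ((hrT M hM a b _).1 h)).symm
  · exact fun h => hρ₂ (hT.mem_of_forall_sat hρs fun M _ hM =>
      ⟨fun _ => ArithStructure.zero, (hcon M hM _).1 (hM _ h _)⟩)
  · exact fun h => hρ₁ (hT.mem_of_forall_sat hρs fun M _ hM =>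
      ⟨fun _ => ArithStructure.zero, not_not.1 fun h' => hM _ h _ ((hcon M hM _).2 h')⟩)

end PeanoArith

theorem mainTheorem8 (T : Set PeanoArith.Formula) (hT : PeanoArith.IsTheory T)
    (hcons : PeanoArith.Consistent T) (hce : PeanoArith.IsComputablyEnumerable T)
    (hPA : PeanoArith.IsExtension T PeanoArith.PA) :
    (∃ r : PeanoArith.Formula, PeanoArith.CorrectlyRepresents₂ T r PeanoArith.cat) ∧
    ∀ r : PeanoArith.Formula, PeanoArith.CorrectlyRepresents₂ T r PeanoArith.cat →
      ∃ Pvb : PeanoArith.Formula, PeanoArith.IsWeakProvabilityPredicate T Pvb ∧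
        PeanoArith.Undecidable T (PeanoArith.consistencyStatement r Pvb) :=
  ⟨PeanoArith.exists_correctlyRepresents₂ hT hPA PeanoArith.primrec₂_cat.to_comp,
    PeanoArith.exists_weakProvabilityPredicate_undecidable T hT hcons hce hPA⟩
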